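/- **Conventions.** C*-algebras need not be unital; "f.d.s.a." means finite dimensional and self-adjoint. For C*-algebras $A,B$ let $\|\cdot\|_{\min}$ and $\|\cdot\|_{\max}$ be the minimal and the maximal C*-norm on the algebraic tensor product $A\otimes B$. A C*-algebra $A$ has the LLP if $\|\cdot\|_{\min}=\|\cdot\|_{\max}$ on $A\otimes B(\ell_2)$. For a self-adjoint subspace $E$ of a C*-algebra, a C*-algebra $B$ and $\varepsilon>0$, a linear map $\psi:E\to B$ is an $\varepsilon$-morphism if $\|\psi\|\le 1+\varepsilon$, $\|\psi(xy)-\psi(x)\psi(y)\|\le\varepsilon\|x\|\|y\|$ for all $x,y\in E$ with $xy\in E$, and $\psi(x^*)=\psi(x)^*$ for all $x\in E$. A surjective $*$-homomorphism $q:C\to B$ of C*-algebras almost allows liftings if for every $\varepsilon>0$ and every f.d.s.a. subspace $\mathcal E\subset B$ there is an $\varepsilon$-morphism $\psi:\mathcal E\to C$ with $\|q\psi(x)-x\|\le\varepsilon\|x\|$ for all $x\in\mathcal E$. **Theorem.** Let $C_n,B_n$ $(n\ge 0)$ be C*-algebras such that every $C_n$ has the LLP, let $i_n:C_n\to B_n$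 be isometric $*$-homomorphisms, and let $q_n:C_{n+1}\to B_n$ be surjective $*$-homomorphisms that almost allow liftings. For each $n\ge 0$ let there be given an f.d.s.a. subspace $E_n^0\subset C_n$ and a correspondence which associates to each f.d.s.a. subspace $E\subset C_n$ an f.d.s.a. subspace $\mathcal E[n,E]\subset B_n$ and a number $\varepsilon[n,E]>0$. Let $\delta_n>0$ with $\delta_n\to 0$, and let $\mathcal L=\ell_\infty(\{C_n\})/c_0(\{C_n\})$. Then there are a C*-subalgebra $A\subset\mathcal L$ and f.d.s.a. subspaces $Y_0\subset Y_1\subset\cdots\subset A$ with $\overline{\bigcup_n Y_n}=A$ such that for each $n\ge 0$ there are f.d.s.a. subspaces $E_n\subset C_n$ and $\mathcal E_n\subset B_n$ with $$i_n(E_n)\subset\mathcal E_n,\qquad E_n\supset E_n^0,\qquad \mathcal E_n\supset\mathcal E[n,E_n],$$ for which the inclusion $Y_n\to Y_{n+1}$ factors as $$Y_n\xrightarrow{\ \beta_n\ }E_n\xrightarrow{\ i_n|_{E_n}\ }\mathcal E_n\xrightarrow{\ \gamma_n\ }Y_{n+1},$$ where $\beta_n$ is a linear isomorphism with $\max\{\|\beta_n\|_{cb},\|\beta_n^{-1}\|_{cb}\}\le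 1+\delta_n$, where $\gamma_n$ is linear, and where $\gamma_n$ and $\beta_n^{-1}$ are $\delta_n$-morphisms into $\mathcal L$. Moreover, this can be done so that, in addition, for each $n$ the map $\gamma_n$ is an $\varepsilon[n,E_n]$-morphism into $\mathcal L$. -/

import Mathlib

open scoped ENNReal TensorProduct Topology

noncomputable section

namespace WepLlp

/-! ### Tensor products of C*-algebras, nuclear pairs and the LLP -/

section Tensor

universe u v

/-- A representation of a (not necessarily unital) C*-algebra on a complex Hilbert space.
Every C*-algebra has a faithful representation on a Hilbert space in its own universe. -/
structure HilbertRep (A : Type u) [NonUnitalCStarAlgebra A] where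
  H : Type u
  [normed : NormedAddCommGroup H]
  [inner : InnerProductSpace ℂ H]
  [complete : CompleteSpace H]
  toHom : A →⋆ₙₐ[ℂ] (H →L[ℂ] H)

attribute [instance] HilbertRep.normed HilbertRep.inner HilbertRep.complete

variable {A : Type u} {B : Type v} [NonUnitalCStarAlgebra A] [NonUnitalCStarAlgebra B]

/-- The map `π ⊗ ρ` on the algebraic tensor product `A ⊗ B`: `(π ⊗ ρ)(a ⊗ b)` is the operator
`π a ⊗ ρ b` on the algebraic tensor product of the two Hilbert spaces. -/
def HilbertRep.tensor (π : HilbertRep A) (ρ : HilbertRep B) :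
    A ⊗[ℂ] B →ₗ[ℂ] (π.H ⊗[ℂ] ρ.H →ₗ[ℂ] π.H ⊗[ℂ] ρ.H) :=
  TensorProduct.lift <| LinearMap.mk₂ ℂ
    (fun a b => TensorProduct.map (π.toHom a).toLinearMap (ρ.toHom b).toLinearMap)
    (fun a a' b => by
      rw [map_add, ContinuousLinearMap.toLinearMap_add, TensorProduct.map_add_left])
    (fun c a b => by
      rw [map_smul, ContinuousLinearMap.toLinearMap_smul, TensorProduct.map_smul_left])
    (fun a b b' => by
      rw [map_add, ContinuousLinearMap.toLinearMap_add, TensorProduct.map_add_right])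
    (fun c a b => by
      rw [map_smul, ContinuousLinearMap.toLinearMap_smul, TensorProduct.map_smul_right])

/-- The minimal (spatial) C*-norm on the algebraic tensor product `A ⊗ B`, that is, the supremum
over all representations `π` of `A` and `ρ` of `B` of the operator norm of `(π ⊗ ρ)(t)`. The
operator norm is computed on vectors `ξ` in the unit ball of the algebraic tensor product with its
Hilbert tensor norm, which is dense in the unit ball of its completion. -/
def minNorm (t : A ⊗[ℂ] B) : ℝ≥0∞ :=
  ⨆ (π : HilbertRep A) (ρ : HilbertRep B) (ξ : π.H ⊗[ℂ] ρ.H) (_ : ‖ξ‖ ≤ 1),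
    ENNReal.ofReal ‖π.tensor ρ t ξ‖

/-- C*-seminorms on the *-algebra `A ⊗ B`. -/
structure IsCStarSeminorm (p : Seminorm ℂ (A ⊗[ℂ] B)) : Prop where
  mul_le : ∀ x y, p (x * y) ≤ p x * p y
  star_mul_self : ∀ x, p (star x * x) = p x ^ 2

/-- The maximal C*-norm on the algebraic tensor product `A ⊗ B`. -/
def maxNorm (t : A ⊗[ℂ] B) : ℝ≥0∞ :=
  ⨆ (p : Seminorm ℂ (A ⊗[ℂ] B)) (_ : IsCStarSeminorm p), ENNReal.ofReal (p t)

variable (A B) in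
/-- `(A, B)` is a nuclear pair: the minimal and the maximal C*-norms coincide on `A ⊗ B`. -/
def IsNuclearPair : Prop := ∀ t : A ⊗[ℂ] B, minNorm t = maxNorm t

/-- The Hilbert space `ℓ₂`. -/
abbrev EllTwo : Type := lp (fun _ : ℕ => ℂ) 2

variable (A) in
/-- The local lifting property: `A ⊗_min B(ℓ₂) = A ⊗_max B(ℓ₂)`. -/
def HasLLP : Prop := IsNuclearPair A (EllTwo →L[ℂ] EllTwo)

end Tensor

/-! ### Operator space structure: matrix norms and completely bounded norms -/

section CB

variable {A B : Type*} [NonUnitalCStarAlgebra A] [NonUnitalCStarAlgebra B]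

/-- The norm of the C*-algebra `M_N(A)`. -/
def matrixNorm {N : ℕ} (M : Matrix (Fin N) (Fin N) A) : ℝ :=
  letI : PartialOrder A := CStarAlgebra.spectralOrder A
  letI : StarOrderedRing A := CStarAlgebra.spectralOrderedRing A
  ‖CStarMatrix.ofMatrix M‖

/-- The c.b. norm of a linear map between subspaces of C*-algebras (`∞` if it is not c.b.). -/
def cbNorm {E : Submodule ℂ A} {F : Submodule ℂ B} (u : E →ₗ[ℂ] F) : ℝ≥0∞ :=
  ⨆ (N : ℕ) (x : Matrix (Fin N) (Fin N) E) (_ : matrixNorm (x.map fun e => (e : A)) ≤ 1),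
    ENNReal.ofReal (matrixNorm (x.map fun e => (u e : B)))

end CB

/-! ### Approximate morphisms and liftings -/

section Morphisms

variable {A B D : Type*} [NonUnitalCStarAlgebra A] [NonUnitalCStarAlgebra B]
  [NonUnitalCStarAlgebra D]

/-- Finite dimensional self-adjoint (f.d.s.a.) subspaces. -/
structure IsFDSA (E : Submodule ℂ A) : Prop where
  finiteDimensional : FiniteDimensional ℂ E
  star_mem : ∀ x ∈ E, star x ∈ E

/-- `ε`-morphisms `ψ : E → B` on a self-adjoint subspace `E` of a C*-algebra: `‖ψ‖ ≤ 1 + ε`,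
`‖ψ(xy) - ψ(x)ψ(y)‖ ≤ ε‖x‖‖y‖` whenever `x, y, xy ∈ E`, and `ψ` is self-adjoint. -/
structure IsEpsMorphism (ε : ℝ) (E : Submodule ℂ A) (ψ : E →ₗ[ℂ] B) : Prop where
  norm_le : ∀ x : E, ‖ψ x‖ ≤ (1 + ε) * ‖x‖
  mul_le : ∀ (x y : E) (h : (x * y : A) ∈ E), ‖ψ ⟨x * y, h⟩ - ψ x * ψ y‖ ≤ ε * ‖x‖ * ‖y‖
  star_eq : ∀ (x : E) (h : star (x : A) ∈ E), ψ ⟨star x, h⟩ = star (ψ x)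

/-- `σ : D → B` is almost multiplicatively locally liftable through `q : A → B`. -/
def IsAlmostMulLocallyLiftable (q : A →⋆ₙₐ[ℂ] B) (σ : D →⋆ₙₐ[ℂ] B) : Prop :=
  ∀ ε : ℝ, 0 < ε → ∀ E : Submodule ℂ D, IsFDSA E →
    ∃ ψ : E →ₗ[ℂ] A, IsEpsMorphism ε E ψ ∧ ∀ x : E, ‖q (ψ x) - σ x‖ ≤ ε * ‖x‖

/-- `q : A → B` almost allows liftings (to be used for surjective `q`). -/
def AlmostAllowsLiftings (q : A →⋆ₙₐ[ℂ] B) : Prop :=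
  IsAlmostMulLocallyLiftable q (NonUnitalStarAlgHom.id ℂ B)

end Morphisms

/-! ### The C*-algebra `ℓ_∞({C_n}) / c_0({C_n})` -/

section Corona

open Filter

variable (C : ℕ → Type*) [∀ n, NonUnitalCStarAlgebra (C n)]

/-- The ideal `c_0({C_n})` of `ℓ_∞({C_n})`, as a subspace. -/
def cZero : Submodule ℂ (lp C ∞) where
  carrier := {x | Tendsto (fun n => ‖x n‖) atTop (𝓝 0)}
  zero_mem' := by simp
  add_mem' {x y} hx hy := by
    have h := Tendsto.add hx hy
    rw [add_zero] at h
    exact squeeze_zero (fun n => norm_nonneg _) (fun n => norm_add_le (x n) (y n)) h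
  smul_mem' c x hx := by
    have h := Tendsto.const_mul ‖c‖ hx
    rw [mul_zero] at h
    exact squeeze_zero (fun n => norm_nonneg _) (fun n => (norm_smul c (x n)).le) h

variable {C}

lemma mem_cZero {x : lp C ∞} : x ∈ cZero C ↔ Tendsto (fun n => ‖x n‖) atTop (𝓝 0) := Iff.rfl

lemma mul_mem_cZero_left (x : lp C ∞) {y : lp C ∞} (hy : y ∈ cZero C) : x * y ∈ cZero C := by
  have h := Tendsto.const_mul ‖x‖ (mem_cZero.1 hy)
  rw [mul_zero] at h
  refine squeeze_zero (fun n => norm_nonneg _) (fun n => ?_) h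
  exact (norm_mul_le (x n) (y n)).trans
    (mul_le_mul_of_nonneg_right (lp.norm_apply_le_norm ENNReal.top_ne_zero x n) (norm_nonneg _))

lemma star_mem_cZero {x : lp C ∞} (hx : x ∈ cZero C) : star x ∈ cZero C := by
  have h := mem_cZero.1 hx
  refine mem_cZero.2 (h.congr fun n => ?_)
  exact (norm_star (x n)).symm

lemma mul_mem_cZero_right {x : lp C ∞} (y : lp C ∞) (hx : x ∈ cZero C) : x * y ∈ cZero C := by
  have h := star_mem_cZero (mul_mem_cZero_left (star y) (star_mem_cZero hx))
  simpa using h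

instance isClosed_cZero : IsClosed (cZero C : Set (lp C ∞)) := by
  refine isClosed_of_closure_subset fun x hx => ?_
  refine mem_cZero.2 (Metric.tendsto_atTop.2 fun ε hε => ?_)
  obtain ⟨y, hy, hxy⟩ := Metric.mem_closure_iff.1 hx (ε / 2) (half_pos hε)
  obtain ⟨N, hN⟩ := Metric.tendsto_atTop.1 (mem_cZero.1 hy) (ε / 2) (half_pos hε)
  refine ⟨N, fun n hn => ?_⟩
  have h1 := hN n hn
  rw [Real.dist_0_eq_abs, abs_norm] at h1 ⊢
  rw [dist_eq_norm] at hxy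
  have h2 : ‖x n - y n‖ ≤ ‖x - y‖ := lp.norm_apply_le_norm ENNReal.top_ne_zero (x - y) n
  have h3 : ‖x n‖ ≤ ‖x n - y n‖ + ‖y n‖ := by simpa using norm_add_le (x n - y n) (y n)
  linarith

variable (C) in
/-- The quotient `ℓ_∞({C_n}) / c_0({C_n})`, with the quotient norm. -/
def Corona : Type _ := lp C ∞ ⧸ cZero C

namespace Corona

instance : NormedAddCommGroup (Corona C) := inferInstanceAs (NormedAddCommGroup (lp C ∞ ⧸ cZero C))
instance : NormedSpace ℂ (Corona C) := inferInstanceAs (NormedSpace ℂ (lp C ∞ ⧸ cZero C))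
instance : CompleteSpace (Corona C) := inferInstanceAs (CompleteSpace (lp C ∞ ⧸ cZero C))

/-- The quotient map `Q : ℓ_∞({C_n}) → ℓ_∞({C_n}) / c_0({C_n})`. -/
def mk : lp C ∞ →ₗ[ℂ] Corona C := (cZero C).mkQ

lemma mk_surjective : Function.Surjective (mk (C := C)) := (cZero C).mkQ_surjective

lemma mk_eq_mk {x y : lp C ∞} : mk x = mk y ↔ x - y ∈ cZero C := Submodule.Quotient.eq _

lemma norm_mk_le (x : lp C ∞) : ‖mk x‖ ≤ ‖x‖ := Submodule.Quotient.norm_mk_le _ x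

lemma exists_rep (a : Corona C) {ε : ℝ} (hε : 0 < ε) : ∃ x, mk x = a ∧ ‖x‖ < ‖a‖ + ε :=
  Submodule.Quotient.norm_mk_lt (S := cZero C) a hε

lemma norm_mk_le_of_eventually {x : lp C ∞} {r : ℝ} (hr : 0 ≤ r) (h : ∀ᶠ n in atTop, ‖x n‖ ≤ r) :
    ‖mk x‖ ≤ r := by
  obtain ⟨N, hN⟩ := eventually_atTop.1 h
  let f : ∀ n, C n := fun n => if N ≤ n then x n else 0
  have hf : ∀ n, ‖f n‖ ≤ r := fun n => by
    by_cases hn : N ≤ n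
    · simpa [f, hn] using hN n hn
    · simpa [f, hn] using hr
  let z : lp C ∞ := ⟨f, memℓp_infty ⟨r, by rintro _ ⟨n, rfl⟩; exact hf n⟩⟩
  have hz : mk x = mk z := by
    refine mk_eq_mk.2 (mem_cZero.2 ?_)
    refine tendsto_const_nhds.congr' ?_
    filter_upwards [eventually_ge_atTop N] with n hn
    have : (x - z) n = x n - f n := rfl
    rw [this]
    simp [f, hn]
  rw [hz]
  exact (norm_mk_le z).trans (lp.norm_le_of_forall_le hr hf)

instance : Mul (Corona C) where
  mul := Quotient.map₂ (· * ·) (by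
    intro a a' ha b b' hb
    have ha' := (Submodule.quotientRel_def _).1 ha
    have hb' := (Submodule.quotientRel_def _).1 hb
    refine (Submodule.quotientRel_def _).2 ?_
    have : a * b - a' * b' = a * (b - b') + (a - a') * b' := by
      rw [mul_sub, sub_mul]; abel
    rw [this]
    exact add_mem (mul_mem_cZero_left _ hb') (mul_mem_cZero_right _ ha'))

instance : Star (Corona C) where
  star := Quotient.map star (by
    intro a a' ha
    have ha' := (Submodule.quotientRel_def _).1 ha
    refine (Submodule.quotientRel_def _).2 ?_
    rw [← star_sub]
    exact star_mem_cZero ha')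

lemma mk_mul (x y : lp C ∞) : mk (x * y) = mk x * mk y := rfl

lemma mk_star (x : lp C ∞) : mk (star x) = star (mk x) := rfl

instance : NonUnitalNormedRing (Corona C) where
  left_distrib a b c := by
    obtain ⟨x, rfl⟩ := mk_surjective a
    obtain ⟨y, rfl⟩ := mk_surjective b
    obtain ⟨z, rfl⟩ := mk_surjective c
    simp only [← mk_mul, ← map_add, mul_add]
  right_distrib a b c := by
    obtain ⟨x, rfl⟩ := mk_surjective a
    obtain ⟨y, rfl⟩ := mk_surjective b
    obtain ⟨z, rfl⟩ := mk_surjective c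
    simp only [← mk_mul, ← map_add, add_mul]
  zero_mul a := by
    obtain ⟨x, rfl⟩ := mk_surjective a
    rw [← map_zero (mk (C := C)), ← mk_mul, zero_mul]
  mul_zero a := by
    obtain ⟨x, rfl⟩ := mk_surjective a
    rw [← map_zero (mk (C := C)), ← mk_mul, mul_zero]
  mul_assoc a b c := by
    obtain ⟨x, rfl⟩ := mk_surjective a
    obtain ⟨y, rfl⟩ := mk_surjective b
    obtain ⟨z, rfl⟩ := mk_surjective c
    simp only [← mk_mul, mul_assoc]
  dist_eq := NormedAddCommGroup.dist_eq
  norm_mul_le a b := by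
    refine le_of_forall_pos_le_add fun ε hε => ?_
    have hlim : Tendsto (fun t : ℝ => (‖a‖ + t) * (‖b‖ + t)) (𝓝[>] 0) (𝓝 (‖a‖ * ‖b‖)) := by
      have hc : Continuous fun t : ℝ => (‖a‖ + t) * (‖b‖ + t) := by fun_prop
      simpa using (hc.tendsto 0).mono_left nhdsWithin_le_nhds
    obtain ⟨t, ht, ht0⟩ := ((hlim.eventually_le_const (lt_add_of_pos_right _ hε)).and
      self_mem_nhdsWithin).exists
    obtain ⟨x, rfl, hx⟩ := exists_rep a (show (0 : ℝ) < t from ht0)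
    obtain ⟨y, rfl, hy⟩ := exists_rep b (show (0 : ℝ) < t from ht0)
    rw [← mk_mul]
    exact ((norm_mk_le _).trans (norm_mul_le x y)).trans
      ((mul_le_mul hx.le hy.le (norm_nonneg _) ((norm_nonneg _).trans hx.le)).trans ht)

instance : StarRing (Corona C) where
  star_involutive a := by
    obtain ⟨x, rfl⟩ := mk_surjective a
    simp only [← mk_star, star_star]
  star_mul a b := by
    obtain ⟨x, rfl⟩ := mk_surjective a
    obtain ⟨y, rfl⟩ := mk_surjective b
    simp only [← mk_star, ← mk_mul, star_mul]
  star_add a b := by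
    obtain ⟨x, rfl⟩ := mk_surjective a
    obtain ⟨y, rfl⟩ := mk_surjective b
    simp only [← mk_star, ← map_add, star_add]

instance : CStarRing (Corona C) where
  norm_mul_self_le a := by
    refine le_of_forall_pos_le_add fun ε hε => ?_
    obtain ⟨x, rfl⟩ := mk_surjective a
    obtain ⟨z, hz, hzn⟩ := exists_rep (star (mk x) * mk x) (half_pos hε)
    rw [← mk_star, ← mk_mul] at hz hzn ⊢
    set s : ℝ := ‖mk (star x * x)‖ + ε with hs
    have hs0 : 0 ≤ s := by positivity
    have hev : ∀ᶠ n in atTop, ‖x n‖ ≤ √s := by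
      have h0 := mem_cZero.1 (mk_eq_mk.1 hz.symm)
      filter_upwards [h0.eventually_lt_const (half_pos hε)] with n hn
      refine Real.le_sqrt_of_sq_le ?_
      have h1 : ‖x n‖ ^ 2 = ‖(star x * x) n‖ := by
        rw [sq, ← CStarRing.norm_star_mul_self]; rfl
      have h2 : ‖z n‖ ≤ ‖z‖ := lp.norm_apply_le_norm ENNReal.top_ne_zero z n
      have h3 : ‖(star x * x) n‖ ≤ ‖(star x * x - z) n‖ + ‖z n‖ := by
        have h4 : (star x * x) n = (star x * x - z) n + z n := by
          change _ = ((star x * x) n - z n) + z n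
          abel
        rw [h4]
        exact norm_add_le _ _
      rw [h1]
      linarith
    have h := norm_mk_le_of_eventually (Real.sqrt_nonneg s) hev
    calc ‖mk x‖ * ‖mk x‖ ≤ √s * √s := mul_self_le_mul_self (norm_nonneg _) h
      _ = s := Real.mul_self_sqrt hs0

instance : IsScalarTower ℂ (Corona C) (Corona C) where
  smul_assoc c a b := by
    obtain ⟨x, rfl⟩ := mk_surjective a
    obtain ⟨y, rfl⟩ := mk_surjective b
    simp only [smul_eq_mul, ← map_smul, ← mk_mul, smul_mul_assoc]

instance : SMulCommClass ℂ (Corona C) (Corona C) where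
  smul_comm c a b := by
    obtain ⟨x, rfl⟩ := mk_surjective a
    obtain ⟨y, rfl⟩ := mk_surjective b
    simp only [smul_eq_mul, ← map_smul, ← mk_mul, mul_smul_comm]

instance : StarModule ℂ (Corona C) where
  star_smul c a := by
    obtain ⟨x, rfl⟩ := mk_surjective a
    simp only [← map_smul, ← mk_star, star_smul]

instance : NonUnitalCStarAlgebra (Corona C) where

end Corona

end Corona

end WepLlp

end

/-!
The algebra `A` is the limit, inside `ℓ_∞/c_0`, of an approximate inductive system
`E 0 → E 1 → ⋯` of finite dimensional subspaces `E n ⊆ C n`. The connecting map `E n → E (n + 1)` is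
`ψ n ∘ i n`, where `ψ n` is an approximately multiplicative lifting through `q n` of a large finite
dimensional `F n ⊆ B n` that contains `i n (E n)` and the prescribed subspace. A point `x ∈ E n` is
sent to the class of the sequence of its images in `C n, C (n + 1), …`. Its image `Y n` is a copy of
`E n` whose distortion is controlled by the tail of the errors `τ n`, which shrink geometrically
(`ApproxSystem`). Since `E (n + 1)` is chosen to contain the products of elements of `ψ n (F n)`,
products of elements of `Y n` are limits of elements of `Y m`, `m → ∞`, and the closure of `⋃ Y n` is
an algebra. The tolerances are known as soon as `E n` is, so `τ n` can be chosen to respect them.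

The point is that `ψ n ∘ i n` is almost completely isometric on `E n` (`exists_lifting`). It almost
does not decrease matrix norms because `q n ∘ ψ n` is close to the identity in norm, hence in c.b.
norm on a finite dimensional space. That it almost does not increase them is where the LLP is used
(`HasLLP.exists_forall_matNorm_map_le`). On `A ⊗ B(ℓ₂)` the norm of infinite matrices
(`spatialNorm`) is a C*-norm that dominates the minimal norm (`minNorm_le_spatialNorm`), so under the
LLP it dominates every C*-seminorm. Some `t` in its unit ball detects the c.b. norms on `E` of all
maps at once (`exists_tensor_forall_matNorm_map_le`). If maps `ψ`, multiplicative up to smaller and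
smaller errors on larger and larger subspaces, were not almost completely contractive on `E`, the
limit of the seminorms `‖(ψ ⊗ id) ·‖` along an ultrafilter would be a C*-seminorm exceeding `1` at
`t`.

Matrix norms in `ℓ_∞/c_0` are limits superior of the matrix norms of representing sequences, because
matrices over `ℓ_∞/c_0` embed into the corona algebra of the matrix algebras (`matrixCorona`).
-/

noncomputable section

namespace WepLlp

/-! ### Norms of matrices over a C*-algebra -/

section MatNorm

variable {A B : Type*} [NonUnitalCStarAlgebra A] [NonUnitalCStarAlgebra B]
variable {m n : Type*} [Fintype m] [Fintype n]

section
attribute [local instance] CStarAlgebra.spectralOrder CStarAlgebra.spectralOrderedRing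

/-- The norm of the C*-algebra `M_n(A)`, for an arbitrary finite index type `n`; for `n = Fin N` it
is `matrixNorm`. It is a function on the plain type `Matrix n n A`, since the norm of `CStarMatrix`
depends on a choice of order on `A`. -/
def matNorm (M : Matrix n n A) : ℝ := ‖CStarMatrix.ofMatrix M‖

lemma matNorm_nonneg (M : Matrix n n A) : 0 ≤ matNorm M := norm_nonneg (CStarMatrix.ofMatrix M)

lemma matNorm_zero : matNorm (0 : Matrix n n A) = 0 := norm_zero (E := CStarMatrix n n A)

lemma matNorm_add_le (M M' : Matrix n n A) : matNorm (M + M') ≤ matNorm M + matNorm M' :=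
  norm_add_le (CStarMatrix.ofMatrix M) (CStarMatrix.ofMatrix M')

lemma matNorm_smul (c : ℂ) (M : Matrix n n A) : matNorm (c • M) = ‖c‖ * matNorm M :=
  norm_smul c (CStarMatrix.ofMatrix M)

lemma matNorm_mul_le (M M' : Matrix n n A) : matNorm (M * M') ≤ matNorm M * matNorm M' :=
  norm_mul_le (CStarMatrix.ofMatrix M) (CStarMatrix.ofMatrix M')

lemma matNorm_conjTranspose (M : Matrix n n A) : matNorm M.conjTranspose = matNorm M :=
  norm_star (CStarMatrix.ofMatrix M)

lemma matNorm_conjTranspose_mul_self (M : Matrix n n A) :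
    matNorm (M.conjTranspose * M) = matNorm M ^ 2 :=
  (CStarRing.norm_star_mul_self (x := CStarMatrix.ofMatrix M)).trans (sq _).symm

lemma norm_entry_le_matNorm (M : Matrix n n A) (i j : n) : ‖M i j‖ ≤ matNorm M :=
  CStarMatrix.norm_entry_le_norm (M := CStarMatrix.ofMatrix M)

lemma continuous_matNorm : Continuous (matNorm : Matrix n n A → ℝ) :=
  continuous_norm.comp (CStarMatrix.ofMatrixL (m := n) (n := n) (A := A)).continuous

lemma norm_starHom_eq_matNorm (Φ : Matrix n n A →⋆ₙₐ[ℂ] B) (hΦ : Function.Injective Φ)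
    (M : Matrix n n A) : ‖Φ M‖ = matNorm M :=
  NonUnitalStarAlgHom.norm_map (A := CStarMatrix n n A)
    (F := CStarMatrix n n A →⋆ₙₐ[ℂ] B) Φ hΦ M

lemma matNorm_starHom_le (Φ : A →⋆ₙₐ[ℂ] Matrix n n B) (a : A) :
    matNorm (Φ a) ≤ ‖a‖ :=
  NonUnitalStarAlgHom.norm_apply_le (B := CStarMatrix n n B)
    (F := A →⋆ₙₐ[ℂ] CStarMatrix n n B) Φ a

lemma matNorm_starHom_eq (Φ : Matrix n n A →⋆ₙₐ[ℂ] Matrix m m B) (hΦ : Function.Injective Φ)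
    (M : Matrix n n A) : matNorm (Φ M) = matNorm M :=
  norm_starHom_eq_matNorm (B := CStarMatrix m m B) Φ hΦ M

lemma matNorm_map_le (φ : A →⋆ₙₐ[ℂ] B) (M : Matrix n n A) : matNorm (M.map φ) ≤ matNorm M :=
  NonUnitalStarAlgHom.norm_apply_le (CStarMatrix.mapₙₐ (n := n) φ) (CStarMatrix.ofMatrix M)

lemma matNorm_map_eq (φ : A →⋆ₙₐ[ℂ] B) (hφ : Function.Injective φ) (M : Matrix n n A) :
    matNorm (M.map φ) = matNorm M :=
  NonUnitalStarAlgHom.norm_map (CStarMatrix.mapₙₐ (n := n) φ)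
    (fun _ _ h => CStarMatrix.map_injective hφ h) (CStarMatrix.ofMatrix M)

end

lemma matNorm_sum_le {ι : Type*} (s : Finset ι) (f : ι → Matrix n n A) :
    matNorm (∑ k ∈ s, f k) ≤ ∑ k ∈ s, matNorm (f k) := by
  classical
  induction s using Finset.induction_on with
  | empty => simp [matNorm_zero]
  | insert a s ha ih =>
    rw [Finset.sum_insert ha, Finset.sum_insert ha]
    exact (matNorm_add_le _ _).trans (by gcongr)

lemma matNorm_diagonal_le [DecidableEq n] (a : A) :
    matNorm (Matrix.diagonal fun _ : n => a) ≤ ‖a‖ :=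
  matNorm_starHom_le (n := n)
    { toFun := fun a => Matrix.diagonal fun _ : n => a
      map_smul' := fun c a => by ext i j; simp [Matrix.diagonal_apply]
      map_zero' := by simp
      map_add' := fun a b => by simp [Matrix.diagonal_add]
      map_mul' := fun a b => by simp
      map_star' := fun a => by
        simp [Matrix.star_eq_conjTranspose, Matrix.diagonal_conjTranspose, Pi.star_def] } a

lemma matNorm_blockDiagonal'_le {o : Type*} [Fintype o] [DecidableEq o] {m' : o → Type*}
    [∀ i, Fintype (m' i)] (M : ∀ i, Matrix (m' i) (m' i) A) {r : ℝ} (hr : 0 ≤ r)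
    (h : ∀ i, matNorm (M i) ≤ r) : matNorm (Matrix.blockDiagonal' M) ≤ r := by
  let _ : PartialOrder A := CStarAlgebra.spectralOrder A
  let _ : StarOrderedRing A := CStarAlgebra.spectralOrderedRing A
  let Φ : (∀ i, CStarMatrix (m' i) (m' i) A) →⋆ₙₐ[ℂ] Matrix (Σ i, m' i) (Σ i, m' i) A :=
    { toFun := fun M => Matrix.blockDiagonal' M
      map_smul' := fun c M => Matrix.blockDiagonal'_smul (R := ℂ) c M
      map_zero' := Matrix.blockDiagonal'_zero
      map_add' := fun M M' => Matrix.blockDiagonal'_add M M'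
      map_mul' := fun M M' => Matrix.blockDiagonal'_mul M M'
      map_star' := fun M => (Matrix.blockDiagonal'_conjTranspose M).symm }
  refine (matNorm_starHom_le Φ (fun i => CStarMatrix.ofMatrix (M i))).trans ?_
  exact (pi_norm_le_iff_of_nonneg hr).2 h

/-! ### Products with scalar matrices -/

/-- The scalar matrix and `M` are multiplied in the matrix algebra over the unitization of `A`. -/
lemma matNorm_scalar_mul_le [DecidableEq n] (b : Matrix n n ℂ) (M : Matrix n n A) :
    matNorm (Matrix.of fun i j => ∑ k, b i k • M k j) ≤ matNorm b * matNorm M := by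
  let inr : A →⋆ₙₐ[ℂ] Unitization ℂ A := Unitization.inrNonUnitalStarAlgHom ℂ A
  let sc : ℂ →⋆ₙₐ[ℂ] Unitization ℂ A := (StarAlgHom.ofId ℂ (Unitization ℂ A)).toNonUnitalStarAlgHom
  have hinj : Function.Injective inr := Unitization.inr_injective
  rw [← matNorm_map_eq inr hinj, ← matNorm_map_eq inr hinj M]
  have h : (Matrix.of fun i j => ∑ k, b i k • M k j).map inr = b.map sc * M.map inr := by
    ext1 i j
    simp only [Matrix.map_apply, Matrix.of_apply, Matrix.mul_apply, map_sum, map_smul]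
    refine Finset.sum_congr rfl fun k _ => ?_
    change _ = algebraMap ℂ (Unitization ℂ A) (b i k) * _
    rw [Algebra.smul_def]
  rw [h]
  exact (matNorm_mul_le _ _).trans
    (mul_le_mul_of_nonneg_right (matNorm_map_le sc b) (matNorm_nonneg _))

lemma matNorm_mul_scalar_le [DecidableEq n] (b : Matrix n n ℂ) (M : Matrix n n A) :
    matNorm (Matrix.of fun i j => ∑ k, b k j • M i k) ≤ matNorm b * matNorm M := by
  have h := matNorm_scalar_mul_le b.conjTranspose M.conjTranspose
  rw [matNorm_conjTranspose, matNorm_conjTranspose] at h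
  rw [← matNorm_conjTranspose]
  convert h using 2
  ext i j
  simp [Matrix.conjTranspose_apply, star_sum, star_smul]

lemma matNorm_tensor_le [DecidableEq n] (b : Matrix n n ℂ) (a : A) :
    matNorm (b.map fun z => z • a) ≤ matNorm b * ‖a‖ := by
  have h := matNorm_scalar_mul_le b (Matrix.diagonal fun _ : n => a)
  refine le_trans (le_of_eq ?_)
    (h.trans (mul_le_mul_of_nonneg_left (matNorm_diagonal_le a) (matNorm_nonneg _)))
  congr 1
  ext i j
  simp [Matrix.diagonal_apply]

/-! ### Corners of matrices -/

section Padding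

variable {n : Type*} [DecidableEq n]

/-- The matrix `M`, placed in the rows and columns in the range of `f` and padded with zeros. -/
def padFun (f : m ↪ n) (M : Matrix m m A) : Matrix n n A :=
  Matrix.of fun i j => ∑ r, ∑ s, if f r = i ∧ f s = j then M r s else 0

lemma padFun_apply (f : m ↪ n) (M : Matrix m m A) (r s : m) :
    padFun f M (f r) (f s) = M r s := by
  classical
  simp [padFun, ite_and]

lemma padFun_apply_left (f : m ↪ n) (M : Matrix m m A) {i : n}
    (hi : i ∉ Set.range f) (j : n) : padFun f M i j = 0 := by
  have h : ∀ r, f r ≠ i := fun r hr => hi ⟨r, hr⟩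
  simp [padFun, h]

lemma padFun_apply_right (f : m ↪ n) (M : Matrix m m A) (i : n) {j : n}
    (hj : j ∉ Set.range f) : padFun f M i j = 0 := by
  have h : ∀ r, f r ≠ j := fun r hr => hj ⟨r, hr⟩
  simp [padFun, h]

lemma padFun_ext (f : m ↪ n) {M : Matrix m m A} {X : Matrix n n A}
    (h : ∀ r s, M r s = X (f r) (f s)) (hl : ∀ i ∉ Set.range f, ∀ j, X i j = 0)
    (hr : ∀ j ∉ Set.range f, ∀ i, X i j = 0) : padFun f M = X := by
  ext i j
  by_cases hi : i ∈ Set.range f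
  · by_cases hj : j ∈ Set.range f
    · obtain ⟨r, rfl⟩ := hi
      obtain ⟨s, rfl⟩ := hj
      rw [padFun_apply, h]
    · rw [padFun_apply_right f M i hj, hr j hj]
  · rw [padFun_apply_left f M hi, hl i hi]

end Padding

/-- Padding with zeros, as a `*`-homomorphism. -/
def padMatrix [DecidableEq n] (f : m ↪ n) : Matrix m m A →⋆ₙₐ[ℂ] Matrix n n A where
  toFun := padFun f
  map_smul' c M := padFun_ext f (fun r s => by simp [padFun_apply])
    (fun i hi j => by simp [padFun_apply_left f M hi])
    (fun j hj i => by simp [padFun_apply_right f M i hj])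
  map_zero' := padFun_ext f (fun r s => by simp) (fun i hi j => by simp) (fun j hj i => by simp)
  map_add' M M' := padFun_ext f (fun r s => by simp [padFun_apply])
    (fun i hi j => by simp [padFun_apply_left f _ hi])
    (fun j hj i => by simp [padFun_apply_right f _ i hj])
  map_mul' M M' := padFun_ext f
    (fun r s => by
      simp only [Matrix.mul_apply]
      refine Finset.sum_of_injOn f f.injective.injOn (by simp) (fun k _ hk => ?_) fun t _ => ?_
      · rw [padFun_apply_right f M _ (by simpa using hk), zero_mul]
      · rw [padFun_apply, padFun_apply])
    (fun i hi j => by simp [Matrix.mul_apply, padFun_apply_left f _ hi])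
    (fun j hj i => by simp [Matrix.mul_apply, padFun_apply_right f _ _ hj])
  map_star' M := padFun_ext f (fun r s => by simp [Matrix.star_apply, padFun_apply])
    (fun i hi j => by simp [Matrix.star_apply, padFun_apply_right f _ _ hi])
    (fun j hj i => by simp [Matrix.star_apply, padFun_apply_left f _ hj])

lemma matNorm_padFun [DecidableEq n] (f : m ↪ n) (M : Matrix m m A) :
    matNorm (padFun f M) = matNorm M := by
  refine matNorm_starHom_eq (padMatrix f) (fun M M' h => ?_) M
  ext r s
  have h' : padFun f M (f r) (f s) = padFun f M' (f r) (f s) := congrFun (congrFun h _) _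
  rwa [padFun_apply, padFun_apply] at h'

lemma matNorm_diagonal_indicator_le [DecidableEq n] (p : n → Prop) [DecidablePred p] :
    matNorm (Matrix.diagonal fun i => if p i then (1 : ℂ) else 0) ≤ 1 := by
  set P : Matrix n n ℂ := Matrix.diagonal fun i => if p i then (1 : ℂ) else 0 with hP
  have h : P.conjTranspose * P = P := by
    rw [hP, Matrix.diagonal_conjTranspose, Matrix.diagonal_mul_diagonal]
    congr 1
    ext i
    by_cases hi : p i <;> simp [hi]
  have h1 := matNorm_conjTranspose_mul_self P
  rw [h] at h1
  nlinarith [matNorm_nonneg P]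

/-- The norm of a corner is at most the norm of the matrix. -/
lemma matNorm_submatrix_le (f : m ↪ n) (M : Matrix n n A) :
    matNorm (M.submatrix f f) ≤ matNorm M := by
  classical
  -- the padded corner is `P M P`, for a diagonal projection `P`
  let P : Matrix n n ℂ := Matrix.diagonal fun i => if i ∈ Set.range f then (1 : ℂ) else 0
  have hP : matNorm P ≤ 1 := matNorm_diagonal_indicator_le _
  rw [← matNorm_padFun f]
  have h : padFun f (M.submatrix f f) =
      Matrix.of fun i j => ∑ k, P k j • (Matrix.of fun i j => ∑ k, P i k • M k j) i k := by
    refine padFun_ext f (fun r s => ?_) (fun i hi j => ?_) (fun j hj i => ?_)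
    · simp [P, Matrix.diagonal_apply]
    · simp only [P, Matrix.diagonal_apply, Matrix.of_apply, hi]
      simp
    · simp only [P, Matrix.diagonal_apply, Matrix.of_apply]
      refine Finset.sum_eq_zero fun k _ => ?_
      by_cases hk : k = j
      · subst hk
        simp only [if_true, if_neg hj, zero_smul]
      · rw [if_neg hk, zero_smul]
  rw [h]
  have h1 := matNorm_mul_scalar_le P (Matrix.of fun i j => ∑ k, P i k • M k j)
  have h2 := matNorm_scalar_mul_le P M
  have h3 := matNorm_nonneg M
  have h4 := matNorm_nonneg P
  have h5 := matNorm_nonneg (Matrix.of fun i j => ∑ k, P i k • M k j)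
  nlinarith

/-- For a rectangular matrix `W`, every square block `W'` of `W` formed by some of the rows
satisfies `‖W'‖² ≤ ‖W* W‖`. -/
lemma sq_matNorm_submatrix_le (f : m ↪ n) (W : Matrix n m A) :
    matNorm (W.submatrix f id) ^ 2 ≤ matNorm (W.conjTranspose * W) := by
  classical
  -- complete `W` to a square matrix `X` by zero columns
  let X : Matrix n n A := Matrix.of fun k j => ∑ s, if f s = j then W k s else 0
  have hXf : ∀ k s, X k (f s) = W k s := fun k s => by simp [X]
  have hX0 : ∀ k, ∀ j ∉ Set.range f, X k j = 0 := fun k j hj => by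
    have h : ∀ s, f s ≠ j := fun s hs => hj ⟨s, hs⟩
    simp [X, h]
  have h1 : padFun f (W.conjTranspose * W) = X.conjTranspose * X := by
    refine padFun_ext f (fun r s => ?_) (fun i hi j => ?_) (fun j hj i => ?_)
    · simp [Matrix.mul_apply, hXf]
    · simp [Matrix.mul_apply, hX0 _ i hi]
    · simp [Matrix.mul_apply, hX0 _ j hj]
  have h2 : W.submatrix f id = X.submatrix f f := by
    ext r s
    simp [hXf]
  rw [← matNorm_padFun f (W.conjTranspose * W), h1, matNorm_conjTranspose_mul_self, h2]
  exact pow_le_pow_left₀ (matNorm_nonneg _) (matNorm_submatrix_le f X) 2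

/-! ### Matrices of operators on a Hilbert space -/

section Hilbert

variable {H : Type*} [NormedAddCommGroup H] [InnerProductSpace ℂ H] [CompleteSpace H]

open ContinuousLinearMap

lemma adjoint_proj_apply [DecidableEq n] (r : n) (y : H) :
    adjoint (PiLp.proj 2 (𝕜 := ℂ) (fun _ : n => H) r) y = WithLp.toLp 2 (Pi.single r y) := by
  refine ext_inner_right ℂ fun x => ?_
  rw [adjoint_inner_left, PiLp.inner_apply, Finset.sum_eq_single r]
  · simp
  · intro k _ hk
    simp [Pi.single_eq_of_ne hk]
  · simp

/-- The operator on `H^n` given by a matrix of operators on `H`. -/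
def operatorOfMatrix (X : Matrix n n (H →L[ℂ] H)) :
    PiLp 2 (fun _ : n => H) →L[ℂ] PiLp 2 (fun _ : n => H) :=
  ∑ r, ∑ s, (adjoint (PiLp.proj 2 (𝕜 := ℂ) (fun _ : n => H) r)) ∘L X r s ∘L
    PiLp.proj 2 (𝕜 := ℂ) (fun _ : n => H) s

lemma operatorOfMatrix_apply (X : Matrix n n (H →L[ℂ] H)) (g : PiLp 2 (fun _ : n => H)) (r : n) :
    operatorOfMatrix X g r = ∑ s, X r s (g s) := by
  classical
  simp only [operatorOfMatrix, sum_apply, comp_apply, adjoint_proj_apply, WithLp.ofLp_sum,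
    Finset.sum_apply, PiLp.proj_apply]
  rw [Finset.sum_eq_single r]
  · simp
  · intro k _ hk
    simp [Pi.single_eq_of_ne hk.symm]
  · simp

/-- Matrices of operators on `H` act on `H^n`, as a `*`-homomorphism. -/
def operatorOfMatrixHom :
    Matrix n n (H →L[ℂ] H) →⋆ₙₐ[ℂ] (PiLp 2 (fun _ : n => H) →L[ℂ] PiLp 2 (fun _ : n => H)) where
  toFun := operatorOfMatrix
  map_smul' c X := by
    ext g r
    simp [operatorOfMatrix_apply, Finset.smul_sum]
  map_zero' := by ext g r; simp [operatorOfMatrix_apply]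
  map_add' X Y := by
    ext g r
    simp [operatorOfMatrix_apply, Finset.sum_add_distrib]
  map_mul' X Y := by
    ext g r
    change _ = operatorOfMatrix X (operatorOfMatrix Y g) r
    simp only [operatorOfMatrix_apply, Matrix.mul_apply, sum_apply, map_sum]
    exact Finset.sum_comm
  map_star' X := by
    simp only [operatorOfMatrix, star_eq_adjoint, map_sum, adjoint_comp, adjoint_adjoint,
      Matrix.star_apply]
    rw [Finset.sum_comm]
    rfl

lemma operatorOfMatrix_injective : Function.Injective
    (operatorOfMatrix : Matrix n n (H →L[ℂ] H) → _) := by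
  classical
  intro X Y h
  ext r s y
  have h1 := congrArg (fun T => T (WithLp.toLp 2 (Pi.single s y)) r) h
  simp only [operatorOfMatrix_apply] at h1
  rwa [Finset.sum_eq_single s (by intro k _ hk; simp [Pi.single_eq_of_ne hk]) (by simp),
    Finset.sum_eq_single s (by intro k _ hk; simp [Pi.single_eq_of_ne hk]) (by simp),
    Pi.single_eq_same] at h1

lemma norm_operatorOfMatrix (X : Matrix n n (H →L[ℂ] H)) : ‖operatorOfMatrix X‖ = matNorm X := by
  have h := norm_starHom_eq_matNorm
    (B := PiLp 2 (fun _ : n => H) →L[ℂ] PiLp 2 (fun _ : n => H)) (operatorOfMatrixHom (H := H))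
    operatorOfMatrix_injective X
  exact h

lemma sum_norm_sq_le_matNorm (X : Matrix n n (H →L[ℂ] H)) (g : n → H) :
    ∑ r, ‖∑ s, X r s (g s)‖ ^ 2 ≤ matNorm X ^ 2 * ∑ s, ‖g s‖ ^ 2 := by
  have h := (operatorOfMatrix X).le_opNorm (WithLp.toLp 2 g)
  rw [norm_operatorOfMatrix] at h
  have h2 := pow_le_pow_left₀ (norm_nonneg _) h 2
  rw [mul_pow, PiLp.norm_sq_eq_of_L2, PiLp.norm_sq_eq_of_L2] at h2
  simpa only [operatorOfMatrix_apply] using h2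

lemma matNorm_le_of_sum_norm_sq_le (X : Matrix n n (H →L[ℂ] H)) {K : ℝ} (hK : 0 ≤ K)
    (h : ∀ g : n → H, ∑ r, ‖∑ s, X r s (g s)‖ ^ 2 ≤ K ^ 2 * ∑ s, ‖g s‖ ^ 2) :
    matNorm X ≤ K := by
  rw [← norm_operatorOfMatrix]
  refine opNorm_le_bound _ hK fun g => ?_
  refine le_of_sq_le_sq ?_ (by positivity)
  rw [mul_pow, PiLp.norm_sq_eq_of_L2, PiLp.norm_sq_eq_of_L2]
  simpa only [operatorOfMatrix_apply] using h g

/-- Scalar matrices, viewed as matrices of operators on the Hilbert space `ℂ`. -/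
lemma matNorm_scalar_eq (b : Matrix n n ℂ) :
    matNorm (b.map fun z => (algebraMap ℂ (ℂ →L[ℂ] ℂ) z)) = matNorm b := by
  let sc : ℂ →⋆ₙₐ[ℂ] (ℂ →L[ℂ] ℂ) := (StarAlgHom.ofId ℂ (ℂ →L[ℂ] ℂ)).toNonUnitalStarAlgHom
  exact matNorm_map_eq sc (algebraMap ℂ (ℂ →L[ℂ] ℂ)).injective b

lemma sum_norm_sq_le_matNorm_scalar (b : Matrix n n ℂ) (g : n → ℂ) :
    ∑ r, ‖∑ s, b r s * g s‖ ^ 2 ≤ matNorm b ^ 2 * ∑ s, ‖g s‖ ^ 2 := by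
  rw [← matNorm_scalar_eq]
  exact sum_norm_sq_le_matNorm (b.map fun z => (algebraMap ℂ (ℂ →L[ℂ] ℂ) z)) g

lemma matNorm_scalar_le_of_sum_norm_sq_le (b : Matrix n n ℂ) {K : ℝ} (hK : 0 ≤ K)
    (h : ∀ g : n → ℂ, ∑ r, ‖∑ s, b r s * g s‖ ^ 2 ≤ K ^ 2 * ∑ s, ‖g s‖ ^ 2) :
    matNorm b ≤ K := by
  rw [← matNorm_scalar_eq]
  exact matNorm_le_of_sum_norm_sq_le (b.map fun z => (algebraMap ℂ (ℂ →L[ℂ] ℂ) z)) hK h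

/-- Representations act contractively on `n`-tuples of vectors, entry by entry. -/
lemma sum_norm_sq_le_matNorm_of_rep (π : A →⋆ₙₐ[ℂ] (H →L[ℂ] H)) (X : Matrix n n A) (g : n → H) :
    ∑ r, ‖∑ s, π (X r s) (g s)‖ ^ 2 ≤ matNorm X ^ 2 * ∑ s, ‖g s‖ ^ 2 := by
  refine (sum_norm_sq_le_matNorm (X.map π) g).trans ?_
  gcongr
  · exact matNorm_nonneg _
  · exact matNorm_map_le π X

end Hilbert

/-! ### Complete boundedness of functionals and of maps on finite dimensional spaces -/

/-- `‖α* X β‖ ≤ ‖α‖ ‖X‖ ‖β‖` for scalar vectors. -/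
lemma norm_sum_smul_le_matNorm (X : Matrix n n A) (α β : n → ℂ) :
    ‖∑ r, ∑ s, (α r * β s) • X r s‖ ≤
      √(∑ r, ‖α r‖ ^ 2) * √(∑ s, ‖β s‖ ^ 2) * matNorm X := by
  classical
  rcases isEmpty_or_nonempty n with hn | ⟨⟨o⟩⟩
  · simp
  -- the vectors become the row `o` and the column `o` of two scalar matrices
  let a : Matrix n n ℂ := Matrix.of fun i r => if i = o then α r else 0
  let b : Matrix n n ℂ := Matrix.of fun s j => if j = o then β s else 0
  have ha : matNorm a ≤ √(∑ r, ‖α r‖ ^ 2) := by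
    refine matNorm_scalar_le_of_sum_norm_sq_le a (Real.sqrt_nonneg _) fun g => ?_
    rw [Real.sq_sqrt (by positivity), Finset.sum_eq_single o]
    · simp only [a, Matrix.of_apply, if_true]
      refine (pow_le_pow_left₀ (norm_nonneg _) (norm_sum_le _ _) 2).trans ?_
      simp only [norm_mul]
      exact Finset.sum_mul_sq_le_sq_mul_sq _ _ _
    · intro i _ hi
      simp [a, hi]
    · simp
  have hb : matNorm b ≤ √(∑ s, ‖β s‖ ^ 2) := by
    refine matNorm_scalar_le_of_sum_norm_sq_le b (Real.sqrt_nonneg _) fun g => ?_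
    rw [Real.sq_sqrt (by positivity)]
    have h1 : ∀ r, ∑ s, b r s * g s = β r * g o := fun r => by simp [b]
    simp only [h1, norm_mul, mul_pow, ← Finset.sum_mul]
    gcongr
    exact Finset.single_le_sum (f := fun s => ‖g s‖ ^ 2) (fun _ _ => by positivity)
      (Finset.mem_univ o)
  have h1 := matNorm_scalar_mul_le a X
  have h2 := matNorm_mul_scalar_le b (Matrix.of fun i j => ∑ k, a i k • X k j)
  have h3 := norm_entry_le_matNorm
    (Matrix.of fun i j => ∑ k, b k j • (Matrix.of fun i j => ∑ k, a i k • X k j) i k) o o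
  have h4 : (Matrix.of fun i j => ∑ k, b k j • (Matrix.of fun i j => ∑ k, a i k • X k j) i k) o o =
      ∑ r, ∑ s, (α r * β s) • X r s := by
    simp only [a, b, Matrix.of_apply, if_true, Finset.smul_sum, smul_smul]
    rw [Finset.sum_comm]
    simp only [mul_comm]
  rw [h4] at h3
  calc _ ≤ _ := h3
    _ ≤ _ := h2
    _ ≤ √(∑ s, ‖β s‖ ^ 2) * (√(∑ r, ‖α r‖ ^ 2) * matNorm X) := by
        have := matNorm_nonneg X
        have := matNorm_nonneg a
        gcongr
        · exact matNorm_nonneg _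
        · exact h1.trans (by gcongr)
    _ = _ := by ring

/-- Functionals are completely bounded, with the same norm. -/
lemma matNorm_functional_le (E : Submodule ℂ A) (f : E →ₗ[ℂ] ℂ) {K : ℝ} (hK : 0 ≤ K)
    (hf : ∀ x, ‖f x‖ ≤ K * ‖x‖) (X : Matrix n n E) :
    matNorm (X.map f) ≤ K * matNorm (X.map fun e => (e : A)) := by
  have hX := matNorm_nonneg (X.map fun e => (e : A))
  refine matNorm_scalar_le_of_sum_norm_sq_le _ (by positivity) fun g => ?_
  -- test the vector `v = f(X) g` against itself: `‖v‖² = f (v* X g) ≤ K ‖v‖ ‖X‖ ‖g‖`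
  set v : n → ℂ := fun r => ∑ s, (X.map f) r s * g s with hv
  set V : ℝ := ∑ r, ‖v r‖ ^ 2 with hV
  set G : ℝ := ∑ s, ‖g s‖ ^ 2 with hG
  have hV0 : 0 ≤ V := by positivity
  have hG0 : 0 ≤ G := by positivity
  have h1 : (V : ℂ) = f (∑ r, ∑ s, (star (v r) * g s) • X r s) := by
    simp only [map_sum, map_smul, smul_eq_mul, hV, Complex.ofReal_sum]
    refine Finset.sum_congr rfl fun r _ => ?_
    have h2 : ((‖v r‖ ^ 2 : ℝ) : ℂ) = star (v r) * v r := by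
      rw [← Complex.normSq_eq_norm_sq, Complex.normSq_eq_conj_mul_self]; rfl
    rw [h2]
    conv_lhs => rw [hv]
    simp only [Finset.mul_sum, Matrix.map_apply]
    refine Finset.sum_congr rfl fun s _ => ?_
    simp only [hv, Matrix.map_apply]
    ring
  have h2 : V ≤ K * (√V * √G * matNorm (X.map fun e => (e : A))) := by
    have h3 : ‖(V : ℂ)‖ = V := by rw [Complex.norm_real, Real.norm_of_nonneg hV0]
    have h4 := norm_sum_smul_le_matNorm (X.map fun e => (e : A)) (fun r => star (v r)) g
    simp only [norm_star] at h4
    have h6 := hf (∑ r, ∑ s, (star (v r) * g s) • X r s)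
    rw [← h1, h3] at h6
    refine h6.trans (mul_le_mul_of_nonneg_left (le_trans (le_of_eq ?_) h4) hK)
    rw [← Submodule.norm_coe]
    simp
  have h5 : √V ≤ K * matNorm (X.map fun e => (e : A)) * √G := by
    rcases (Real.sqrt_nonneg V).eq_or_lt with h0 | h0
    · rw [← h0]; positivity
    · have h6 : √V * √V = V := Real.mul_self_sqrt hV0
      refine le_of_mul_le_mul_left ?_ h0
      rw [h6]
      linarith
  have h7 := pow_le_pow_left₀ (Real.sqrt_nonneg V) h5 2
  rwa [mul_pow, Real.sq_sqrt hV0, Real.sq_sqrt hG0] at h7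

/-- On a finite dimensional subspace the c.b. norm is controlled by the norm. -/
lemma exists_matNorm_map_le (E : Submodule ℂ A) [FiniteDimensional ℂ E] :
    ∃ K : ℝ, 0 < K ∧ ∀ (u : E →ₗ[ℂ] B) (η : ℝ), 0 ≤ η → (∀ x, ‖u x‖ ≤ η * ‖x‖) →
      ∀ (N : ℕ) (X : Matrix (Fin N) (Fin N) E),
        matNorm (X.map u) ≤ η * K * matNorm (X.map fun e => (e : A)) := by
  let e := Module.finBasis ℂ E
  let F : ∀ k, E →L[ℂ] ℂ := fun k => LinearMap.toContinuousLinearMap (e.coord k)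
  refine ⟨1 + ∑ k, ‖F k‖ * ‖e k‖, by positivity, fun u η hη hu N X => ?_⟩
  have h1 : X.map u = ∑ k, (X.map (e.coord k)).map fun z => z • u (e k) := by
    ext i j
    rw [Matrix.sum_apply]
    simp only [Matrix.map_apply]
    refine (congrArg u (e.sum_repr (X i j)).symm).trans ?_
    simp only [map_sum, map_smul]
    rfl
  have hX := matNorm_nonneg (X.map fun e => (e : A))
  have h2 : ∀ k, matNorm ((X.map (e.coord k)).map fun z => z • u (e k)) ≤
      η * (‖F k‖ * ‖e k‖) * matNorm (X.map fun e => (e : A)) := fun k => by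
    refine (matNorm_tensor_le _ _).trans ?_
    have h3 := matNorm_functional_le E (e.coord k) (norm_nonneg (F k)) (F k).le_opNorm X
    calc _ ≤ (‖F k‖ * matNorm (X.map fun e => (e : A))) * (η * ‖e k‖) := by
          gcongr
          exact hu _
      _ = _ := by ring
  rw [h1]
  refine (matNorm_sum_le _ _).trans ((Finset.sum_le_sum fun k _ => h2 k).trans ?_)
  rw [← Finset.sum_mul, ← Finset.mul_sum]
  gcongr
  linarith

end MatNorm

/-! ### The spatial norm on `A ⊗ B(ℓ₂)` -/

section TensorMul

variable {A B : Type*} [NonUnitalCStarAlgebra A] [NonUnitalCStarAlgebra B]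

-- Distributivity, stated for general factors: for `B = B(ℓ₂)` the corresponding instances on
-- `A ⊗ B` are not found directly.
lemma tensor_add_mul (x y z : A ⊗[ℂ] B) : (x + y) * z = x * z + y * z := add_mul x y z
lemma tensor_mul_add (x y z : A ⊗[ℂ] B) : x * (y + z) = x * y + x * z := mul_add x y z
lemma tensor_zero_mul (z : A ⊗[ℂ] B) : 0 * z = 0 := zero_mul z
lemma tensor_mul_zero (z : A ⊗[ℂ] B) : z * 0 = 0 := mul_zero z

end TensorMul

section Spatial

open Filter

/-- The standard basis vectors of `ℓ₂`. -/
def stdVec (u : ℕ) : EllTwo := lp.single 2 u (1 : ℂ)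

lemma inner_stdVec (u : ℕ) (g : EllTwo) : inner ℂ (stdVec u) g = g u := by
  rw [stdVec, lp.inner_single_left]
  simp

/-- The matrix coefficients of an operator on `ℓ₂`. -/
def coeff (u v : ℕ) : (EllTwo →L[ℂ] EllTwo) →ₗ[ℂ] ℂ where
  toFun b := inner ℂ (stdVec u) (b (stdVec v))
  map_add' b c := by simp
  map_smul' z b := by simp

lemma coeff_eq (u v : ℕ) (b : EllTwo →L[ℂ] EllTwo) : coeff u v b = b (stdVec v) u :=
  inner_stdVec u _

lemma coeff_star (u v : ℕ) (b : EllTwo →L[ℂ] EllTwo) : coeff u v (star b) = star (coeff v u b) := by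
  change inner ℂ (stdVec u) (star b (stdVec v)) = star (inner ℂ (stdVec v) (b (stdVec u)))
  rw [ContinuousLinearMap.star_eq_adjoint, ContinuousLinearMap.adjoint_inner_right]
  exact (inner_conj_symm _ _).symm

lemma hasSum_coeff_mul (b : EllTwo →L[ℂ] EllTwo) (g : EllTwo) (u : ℕ) :
    HasSum (fun v => coeff u v b * g v) (b g u) := by
  have h := (lp.hasSum_single (p := 2) (by simp) g).mapL
    ((innerSL ℂ (stdVec u)).comp b)
  have h2 : ((innerSL ℂ (stdVec u)).comp b) g = b g u := inner_stdVec u _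
  rw [h2] at h
  have h4 : (fun v => coeff u v b * g v) =
      fun v => (innerSL ℂ (stdVec u)).comp b (lp.single 2 v (g v)) := funext fun v => by
    have h3 : (lp.single 2 v (g v) : EllTwo) = g v • stdVec v := by
      rw [stdVec, ← lp.single_smul]
      simp
    rw [h3, map_smul, smul_eq_mul, mul_comm]
    rfl
  rw [h4]
  exact h

lemma hasSum_norm_sq (g : EllTwo) : HasSum (fun u => ‖g u‖ ^ 2) (‖g‖ ^ 2) := by
  have h := lp.hasSum_norm (p := 2) (by simp) g
  simpa using h

lemma sum_norm_sq_le (g : EllTwo) (S : Finset ℕ) : ∑ u ∈ S, ‖g u‖ ^ 2 ≤ ‖g‖ ^ 2 :=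
  sum_le_hasSum S (fun _ _ => by positivity) (hasSum_norm_sq g)

/-- Finite corners of the matrix of an operator on `ℓ₂` have at most the norm of the operator. -/
lemma matNorm_coeff_le (b : EllTwo →L[ℂ] EllTwo) (S : Finset ℕ) :
    matNorm (Matrix.of fun u v : S => coeff u v b) ≤ ‖b‖ := by
  refine matNorm_scalar_le_of_sum_norm_sq_le _ (norm_nonneg _) fun g => ?_
  let f : ℕ → ℂ := fun u => if h : u ∈ S then g ⟨u, h⟩ else 0
  let G : EllTwo := ∑ u ∈ S, lp.single 2 u (f u)
  have hG : ‖G‖ ^ 2 = ∑ s, ‖g s‖ ^ 2 := by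
    have h := lp.norm_sum_single (p := 2) (by simp) f S
    simp only [ENNReal.toReal_ofNat, Real.rpow_ofNat] at h
    rw [h, ← Finset.sum_coe_sort]
    exact Finset.sum_congr rfl fun s _ => by simp [f]
  have hGu : ∀ u : S, ∑ s, (Matrix.of fun u v : S => coeff u v b) u s * g s = b G u := fun u => by
    rw [← inner_stdVec]
    simp only [G, map_sum, inner_sum]
    rw [← Finset.sum_coe_sort S]
    refine Finset.sum_congr rfl fun s _ => ?_
    have h : (lp.single 2 (s : ℕ) (f s) : EllTwo) = g s • stdVec s := by
      rw [stdVec, ← lp.single_smul]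
      simp [f]
    rw [h, map_smul, inner_smul_right, mul_comm]
    rfl
  simp only [hGu]
  rw [Finset.sum_coe_sort S (fun u => ‖b G u‖ ^ 2), ← hG, ← mul_pow]
  exact (sum_norm_sq_le _ S).trans (pow_le_pow_left₀ (norm_nonneg _) (b.le_opNorm G) 2)

variable {A : Type*} [NonUnitalCStarAlgebra A]

/-- The slice map `a ⊗ b ↦ b_{uv} a` from `A ⊗ B(ℓ₂)` to `A`. -/
def slice (u v : ℕ) : A ⊗[ℂ] (EllTwo →L[ℂ] EllTwo) →ₗ[ℂ] A :=
  (TensorProduct.rid ℂ A).toLinearMap ∘ₗ LinearMap.lTensor A (coeff u v)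

@[simp] lemma slice_tmul (u v : ℕ) (a : A) (b : EllTwo →L[ℂ] EllTwo) :
    slice u v (a ⊗ₜ[ℂ] b) = coeff u v b • a := by
  simp [slice]

lemma slice_star (u v : ℕ) (t : A ⊗[ℂ] (EllTwo →L[ℂ] EllTwo)) :
    slice u v (star t) = star (slice v u t) := by
  induction t with
  | zero => simp
  | tmul a b => rw [TensorProduct.star_tmul, slice_tmul, slice_tmul, coeff_star, star_smul]
  | add x y hx hy => simp only [star_add, map_add, hx, hy]

/-- The matrix of a product is the product of the infinite matrices. -/
lemma hasSum_slice_mul (u v : ℕ) (s t : A ⊗[ℂ] (EllTwo →L[ℂ] EllTwo)) :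
    HasSum (fun k => slice u k s * slice k v t) (slice u v (s * t)) := by
  induction s with
  | zero =>
    rw [tensor_zero_mul, map_zero]
    simpa only [map_zero, zero_mul] using hasSum_zero (α := A)
  | add x y hx hy =>
    rw [tensor_add_mul, map_add]
    simpa only [map_add, add_mul] using hx.add hy
  | tmul a b =>
    induction t with
    | zero =>
      rw [tensor_mul_zero, map_zero]
      simpa only [map_zero, mul_zero] using hasSum_zero (α := A)
    | add x y hx hy =>
      rw [tensor_mul_add, map_add]
      simpa only [map_add, mul_add] using hx.add hy
    | tmul a' b' =>
      rw [Algebra.TensorProduct.tmul_mul_tmul]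
      simp only [slice_tmul, smul_mul_smul_comm]
      have h := hasSum_coeff_mul b (b' (stdVec v)) u
      have h2 : coeff u v (b * b') = b (b' (stdVec v)) u := coeff_eq _ _ _
      rw [← h2] at h
      simp only [← coeff_eq] at h
      exact h.smul_const (a * a')

/-- The corner of `t ∈ A ⊗ B(ℓ₂)` on a finite set of basis vectors, a matrix over `A`. -/
def corner (S : Finset ℕ) (t : A ⊗[ℂ] (EllTwo →L[ℂ] EllTwo)) : Matrix S S A :=
  Matrix.of fun u v => slice u v t

lemma corner_add (S : Finset ℕ) (s t : A ⊗[ℂ] (EllTwo →L[ℂ] EllTwo)) :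
    corner S (s + t) = corner S s + corner S t := by
  ext u v; simp [corner]

lemma corner_smul (S : Finset ℕ) (c : ℂ) (t : A ⊗[ℂ] (EllTwo →L[ℂ] EllTwo)) :
    corner S (c • t) = c • corner S t := by
  ext u v; simp [corner]

lemma corner_star (S : Finset ℕ) (t : A ⊗[ℂ] (EllTwo →L[ℂ] EllTwo)) :
    corner S (star t) = (corner S t).conjTranspose := by
  ext u v; simp [corner, slice_star]

lemma matNorm_corner_tmul_le (S : Finset ℕ) (a : A) (b : EllTwo →L[ℂ] EllTwo) :
    matNorm (corner S (a ⊗ₜ[ℂ] b)) ≤ ‖a‖ * ‖b‖ := by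
  have h : corner S (a ⊗ₜ[ℂ] b) = (Matrix.of fun u v : S => coeff u v b).map fun z => z • a := by
    ext u v; simp [corner]
  rw [h, mul_comm]
  exact (matNorm_tensor_le _ _).trans
    (mul_le_mul_of_nonneg_right (matNorm_coeff_le b S) (norm_nonneg _))

lemma bddAbove_corner (t : A ⊗[ℂ] (EllTwo →L[ℂ] EllTwo)) :
    BddAbove (Set.range fun S : Finset ℕ => matNorm (corner S t)) := by
  induction t with
  | zero =>
    refine ⟨0, ?_⟩
    rintro _ ⟨S, rfl⟩
    have h : corner S (0 : A ⊗[ℂ] (EllTwo →L[ℂ] EllTwo)) = 0 := by ext; simp [corner]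
    simp [h, matNorm_zero]
  | tmul a b =>
    refine ⟨‖a‖ * ‖b‖, ?_⟩
    rintro _ ⟨S, rfl⟩
    exact matNorm_corner_tmul_le S a b
  | add x y hx hy =>
    obtain ⟨K, hK⟩ := hx
    obtain ⟨L, hL⟩ := hy
    refine ⟨K + L, ?_⟩
    rintro _ ⟨S, rfl⟩
    simp only [corner_add]
    exact (matNorm_add_le _ _).trans (add_le_add (hK ⟨S, rfl⟩) (hL ⟨S, rfl⟩))

/-- The norm of `t ∈ A ⊗ B(ℓ₂)` as an infinite matrix over `A`. -/
def spatialNorm (t : A ⊗[ℂ] (EllTwo →L[ℂ] EllTwo)) : ℝ :=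
  ⨆ S : Finset ℕ, matNorm (corner S t)

lemma matNorm_corner_le (S : Finset ℕ) (t : A ⊗[ℂ] (EllTwo →L[ℂ] EllTwo)) :
    matNorm (corner S t) ≤ spatialNorm t :=
  le_ciSup (bddAbove_corner t) S

lemma spatialNorm_le {t : A ⊗[ℂ] (EllTwo →L[ℂ] EllTwo)} {r : ℝ}
    (h : ∀ S, matNorm (corner S t) ≤ r) : spatialNorm t ≤ r :=
  ciSup_le h

lemma spatialNorm_nonneg (t : A ⊗[ℂ] (EllTwo →L[ℂ] EllTwo)) : 0 ≤ spatialNorm t :=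
  (matNorm_nonneg _).trans (matNorm_corner_le ∅ t)

lemma spatialNorm_tmul_le (a : A) (b : EllTwo →L[ℂ] EllTwo) :
    spatialNorm (a ⊗ₜ[ℂ] b) ≤ ‖a‖ * ‖b‖ :=
  spatialNorm_le fun S => matNorm_corner_tmul_le S a b

lemma spatialNorm_add_le (s t : A ⊗[ℂ] (EllTwo →L[ℂ] EllTwo)) :
    spatialNorm (s + t) ≤ spatialNorm s + spatialNorm t :=
  spatialNorm_le fun S => by
    rw [corner_add]
    exact (matNorm_add_le _ _).trans (add_le_add (matNorm_corner_le S s) (matNorm_corner_le S t))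

lemma spatialNorm_smul_le (c : ℂ) (t : A ⊗[ℂ] (EllTwo →L[ℂ] EllTwo)) :
    spatialNorm (c • t) ≤ ‖c‖ * spatialNorm t :=
  spatialNorm_le fun S => by
    rw [corner_smul, matNorm_smul]
    exact mul_le_mul_of_nonneg_left (matNorm_corner_le S t) (norm_nonneg _)

variable (A) in
/-- The spatial C*-norm on `A ⊗ B(ℓ₂)`, as a seminorm. -/
def spatialSeminorm : Seminorm ℂ (A ⊗[ℂ] (EllTwo →L[ℂ] EllTwo)) :=
  Seminorm.ofSMulLE spatialNorm
    (le_antisymm (by simpa using spatialNorm_smul_le (0 : ℂ) (0 : A ⊗[ℂ] (EllTwo →L[ℂ] EllTwo)))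
      (spatialNorm_nonneg _)) spatialNorm_add_le spatialNorm_smul_le

lemma spatialNorm_star (t : A ⊗[ℂ] (EllTwo →L[ℂ] EllTwo)) :
    spatialNorm (star t) = spatialNorm t := by
  simp only [spatialNorm, corner_star, matNorm_conjTranspose]

lemma spatialNorm_mul_le (s t : A ⊗[ℂ] (EllTwo →L[ℂ] EllTwo)) :
    spatialNorm (s * t) ≤ spatialNorm s * spatialNorm t := by
  refine spatialNorm_le fun S => ?_
  let Z : Finset ℕ → Matrix S S A := fun T =>
    Matrix.of fun u v : S => ∑ k ∈ T, slice u k s * slice k v t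
  have hZ : Tendsto Z atTop (𝓝 (corner S (s * t))) :=
    tendsto_pi_nhds.2 fun u => tendsto_pi_nhds.2 fun v => hasSum_slice_mul u v s t
  refine le_of_tendsto ((continuous_matNorm.tendsto _).comp hZ) ?_
  filter_upwards [eventually_ge_atTop S] with T hT
  let f : S ↪ T := ⟨Set.inclusion hT, Set.inclusion_injective hT⟩
  have h : Z T = (corner T s * corner T t).submatrix f f := by
    ext u v
    simp only [Z, Matrix.of_apply, Matrix.submatrix_apply, Matrix.mul_apply, corner]
    exact (Finset.sum_coe_sort T fun k => slice u k s * slice k v t).symm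
  change matNorm (Z T) ≤ _
  rw [h]
  refine (matNorm_submatrix_le f _).trans ((matNorm_mul_le _ _).trans ?_)
  exact mul_le_mul (matNorm_corner_le T s) (matNorm_corner_le T t) (matNorm_nonneg _)
    (spatialNorm_nonneg _)

/-- The nontrivial half of the C*-identity. -/
lemma sq_spatialNorm_le (t : A ⊗[ℂ] (EllTwo →L[ℂ] EllTwo)) :
    spatialNorm t ^ 2 ≤ spatialNorm (star t * t) := by
  suffices h : spatialNorm t ≤ √(spatialNorm (star t * t)) by
    calc _ ≤ √(spatialNorm (star t * t)) ^ 2 := pow_le_pow_left₀ (spatialNorm_nonneg _) h 2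
      _ = _ := Real.sq_sqrt (spatialNorm_nonneg _)
  refine spatialNorm_le fun S => Real.le_sqrt_of_sq_le ?_
  refine le_trans ?_ (matNorm_corner_le S _)
  let Z : Finset ℕ → Matrix S S A := fun T =>
    Matrix.of fun u v : S => ∑ k ∈ T, slice u k (star t) * slice k v t
  have hZ : Tendsto Z atTop (𝓝 (corner S (star t * t))) :=
    tendsto_pi_nhds.2 fun u => tendsto_pi_nhds.2 fun v => hasSum_slice_mul u v (star t) t
  refine ge_of_tendsto ((continuous_matNorm.tendsto _).comp hZ) ?_
  filter_upwards [eventually_ge_atTop S] with T hT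
  let f : S ↪ T := ⟨Set.inclusion hT, Set.inclusion_injective hT⟩
  let W : Matrix T S A := Matrix.of fun k v => slice k v t
  have h : Z T = W.conjTranspose * W := by
    ext u v
    simp only [Z, W, Matrix.of_apply, Matrix.mul_apply, Matrix.conjTranspose_apply, slice_star]
    exact (Finset.sum_coe_sort T fun k => star (slice k u t) * slice k v t).symm
  change _ ≤ matNorm (Z T)
  rw [h]
  exact sq_matNorm_submatrix_le f W

lemma isCStarSeminorm_spatialSeminorm : IsCStarSeminorm (spatialSeminorm A) where
  mul_le := spatialNorm_mul_le
  star_mul_self t := by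
    refine le_antisymm ?_ (sq_spatialNorm_le t)
    refine (spatialNorm_mul_le _ _).trans (le_of_eq ?_)
    rw [spatialNorm_star, sq]
    rfl

end Spatial

/-! ### The minimal norm is dominated by the spatial norm -/

section MinNorm

variable {A : Type*} [NonUnitalCStarAlgebra A]
variable {H K : Type*} [NormedAddCommGroup H] [InnerProductSpace ℂ H]
  [NormedAddCommGroup K] [InnerProductSpace ℂ K]

/-- The slice map `⟨h, ·⟩ ⊗ id`. -/
def braSlice (h : H) : H ⊗[ℂ] K →ₗ[ℂ] K :=
  (TensorProduct.lid ℂ K).toLinearMap ∘ₗ LinearMap.rTensor K (innerSL ℂ h).toLinearMap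

@[simp] lemma braSlice_tmul (h x : H) (y : K) : braSlice h (x ⊗ₜ[ℂ] y) = inner ℂ h x • y := by
  simp [braSlice]

/-- Two tensors in `H ⊗ K` can be expanded over a common finite orthonormal family in `H`. -/
lemma exists_orthonormal_legs (ξ η : H ⊗[ℂ] K) : ∃ (l : ℕ) (f : Fin l → H), Orthonormal ℂ f ∧
    ξ = ∑ s, f s ⊗ₜ[ℂ] braSlice (f s) ξ ∧ η = ∑ s, f s ⊗ₜ[ℂ] braSlice (f s) η := by
  obtain ⟨M, hM, hξη⟩ := TensorProduct.exists_finite_submodule_left_of_setFinite {ξ, η} (by simp)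
  have : FiniteDimensional ℂ M := hM
  let e := stdOrthonormalBasis ℂ M
  have key : ∀ z : M ⊗[ℂ] K, LinearMap.rTensor K M.subtype z = ∑ s, (e s : H) ⊗ₜ[ℂ]
      braSlice (e s : H) (LinearMap.rTensor K M.subtype z) := fun z => by
    induction z with
    | zero => simp
    | add x y hx hy =>
      simp only [map_add, TensorProduct.tmul_add, Finset.sum_add_distrib]
      rw [← hx, ← hy]
    | tmul x y =>
      simp only [LinearMap.rTensor_tmul, Submodule.subtype_apply, braSlice_tmul,
        ← TensorProduct.smul_tmul, ← TensorProduct.sum_tmul]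
      congr 1
      have h := congrArg (fun z : M => (z : H)) (e.sum_repr' x)
      simpa using h.symm
  obtain ⟨ξ', rfl⟩ := hξη (show ξ ∈ _ by simp)
  obtain ⟨η', rfl⟩ := hξη (show η ∈ _ by simp)
  exact ⟨_, fun s => (e s : H), e.orthonormal.comp_linearIsometry M.subtypeₗᵢ, key ξ', key η'⟩

lemma norm_sq_sum_tmul {l : ℕ} {f : Fin l → H} (hf : Orthonormal ℂ f) (g : Fin l → K) :
    ‖∑ s, f s ⊗ₜ[ℂ] g s‖ ^ 2 = ∑ s, ‖g s‖ ^ 2 := by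
  have h : inner ℂ (∑ s, f s ⊗ₜ[ℂ] g s) (∑ s, f s ⊗ₜ[ℂ] g s) = ∑ s, inner ℂ (g s) (g s) := by
    simp only [sum_inner, inner_sum, TensorProduct.inner_tmul]
    refine Finset.sum_congr rfl fun s _ => ?_
    rw [Finset.sum_eq_single s]
    · simp [inner_self_eq_norm_sq_to_K, hf.1 s]
    · intro r _ hr
      rw [hf.2 hr, zero_mul]
    · simp
  have h2 := congrArg Complex.re h
  rw [Complex.re_sum] at h2
  rw [← inner_self_eq_norm_sq (𝕜 := ℂ)]
  refine h2.trans (Finset.sum_congr rfl fun s _ => ?_)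
  exact inner_self_eq_norm_sq (𝕜 := ℂ) (g s)

variable [CompleteSpace H]

/-- The slice map `ω ⊗ id` for the vector functional `ω = ⟨h, π(·) k⟩`. -/
def vectorSlice (π : A →⋆ₙₐ[ℂ] (H →L[ℂ] H)) (h k : H) :
    A ⊗[ℂ] (EllTwo →L[ℂ] EllTwo) →ₗ[ℂ] (EllTwo →L[ℂ] EllTwo) :=
  TensorProduct.lift <| LinearMap.mk₂ ℂ (fun a b => inner ℂ h (π a k) • b)
    (fun a a' b => by simp [add_smul])
    (fun c a b => by simp [mul_smul])
    (fun a b b' => by simp)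
    (fun c a b => by rw [smul_comm])

@[simp] lemma vectorSlice_tmul (π : A →⋆ₙₐ[ℂ] (H →L[ℂ] H)) (h k : H) (a : A)
    (b : EllTwo →L[ℂ] EllTwo) : vectorSlice π h k (a ⊗ₜ[ℂ] b) = inner ℂ h (π a k) • b := by
  simp [vectorSlice]

lemma coeff_vectorSlice (π : A →⋆ₙₐ[ℂ] (H →L[ℂ] H)) (h k : H) (u v : ℕ)
    (t : A ⊗[ℂ] (EllTwo →L[ℂ] EllTwo)) :
    coeff u v (vectorSlice π h k t) = inner ℂ h (π (slice u v t) k) := by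
  induction t with
  | zero => simp
  | add x y hx hy => simp [hx, hy]
  | tmul a b => simp [mul_comm]

/-- Slicing the first leg by an orthonormal family turns `t` into a matrix over `B(ℓ₂)` whose norm
is at most the spatial norm. Testing on finitely many coordinates of `ℓ₂` reduces this to finite
corners of `t`, represented on sums of copies of `H`. -/
lemma matNorm_vectorSlice_le (π : A →⋆ₙₐ[ℂ] (H →L[ℂ] H)) {l : ℕ} {f : Fin l → H}
    (hf : Orthonormal ℂ f) (t : A ⊗[ℂ] (EllTwo →L[ℂ] EllTwo)) :
    matNorm (Matrix.of fun r s => vectorSlice π (f r) (f s) t) ≤ spatialNorm t := by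
  refine matNorm_le_of_sum_norm_sq_le _ (spatialNorm_nonneg t) fun g => ?_
  set y : Fin l → Fin l → EllTwo →L[ℂ] EllTwo := fun r s => vectorSlice π (f r) (f s) t with hy
  simp only [Matrix.of_apply]
  -- the estimate for truncated vectors and truncated values
  have h1 : ∀ S W : Finset ℕ, S ⊆ W →
      ∑ r, ∑ u ∈ S, ‖∑ s, ∑ v ∈ W, coeff u v (y r s) * g s v‖ ^ 2 ≤
        spatialNorm t ^ 2 * ∑ s, ‖g s‖ ^ 2 := fun S W hSW => by
    let k : W → H := fun v => ∑ s, g s v • f s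
    have hk : ∑ v, ‖k v‖ ^ 2 ≤ ∑ s, ‖g s‖ ^ 2 := by
      have h2 : ∀ v, ‖k v‖ ^ 2 = ∑ s, ‖g s v‖ ^ 2 := fun v => by
        rw [← inner_self_eq_norm_sq (𝕜 := ℂ), hf.inner_sum]
        simp only [map_sum]
        refine Finset.sum_congr rfl fun s _ => ?_
        rw [← Complex.normSq_eq_conj_mul_self, Complex.normSq_eq_norm_sq]
        exact Complex.ofReal_re _
      simp only [h2]
      rw [Finset.sum_comm]
      refine Finset.sum_le_sum fun s _ => ?_
      rw [Finset.sum_coe_sort W fun v => ‖g s v‖ ^ 2]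
      exact sum_norm_sq_le _ _
    have h3 := sum_norm_sq_le_matNorm_of_rep π (corner W t) k
    have h4 : ∀ r, ∀ u : W, ∑ s, ∑ v ∈ W, coeff u v (y r s) * g s v =
        inner ℂ (f r) (∑ v, π (corner W t u v) (k v)) := fun r u => by
      simp only [k, hy, coeff_vectorSlice, map_sum, map_smul, inner_sum, inner_smul_right, corner,
        Matrix.of_apply]
      rw [Finset.sum_comm, ← Finset.sum_coe_sort W]
      simp only [mul_comm]
    calc ∑ r, ∑ u ∈ S, ‖∑ s, ∑ v ∈ W, coeff u v (y r s) * g s v‖ ^ 2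
        ≤ ∑ r, ∑ u ∈ W, ‖∑ s, ∑ v ∈ W, coeff u v (y r s) * g s v‖ ^ 2 := by
          gcongr
      _ = ∑ u : W, ∑ r, ‖inner ℂ (f r) (∑ v, π (corner W t u v) (k v))‖ ^ 2 := by
          rw [Finset.sum_comm, ← Finset.sum_coe_sort W]
          simp only [h4]
      _ ≤ ∑ u : W, ‖∑ v, π (corner W t u v) (k v)‖ ^ 2 :=
          Finset.sum_le_sum fun u _ => hf.sum_inner_products_le _
      _ ≤ matNorm (corner W t) ^ 2 * ∑ v, ‖k v‖ ^ 2 := h3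
      _ ≤ _ := by
          gcongr
          · exact matNorm_nonneg _
          · exact matNorm_corner_le W t
  have h2 : ∀ S : Finset ℕ, ∑ r, ∑ u ∈ S, ‖(∑ s, y r s (g s) : EllTwo) u‖ ^ 2 ≤
        spatialNorm t ^ 2 * ∑ s, ‖g s‖ ^ 2 := fun S => by
    refine le_of_tendsto (x := Filter.atTop) (f := fun W : Finset ℕ =>
      ∑ r, ∑ u ∈ S, ‖∑ s, ∑ v ∈ W, coeff u v (y r s) * g s v‖ ^ 2) ?_ ?_
    · refine tendsto_finsetSum _ fun r _ => tendsto_finsetSum _ fun u _ => ?_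
      refine ((?_ : Filter.Tendsto _ _ _).norm).pow 2
      rw [lp.coeFn_sum, Finset.sum_apply]
      exact tendsto_finsetSum _ fun s _ => hasSum_coeff_mul (y r s) (g s) u
    · filter_upwards [Filter.eventually_ge_atTop S] with W hW using h1 S W hW
  refine le_of_tendsto (x := Filter.atTop) (f := fun S : Finset ℕ =>
      ∑ r, ∑ u ∈ S, ‖(∑ s, y r s (g s) : EllTwo) u‖ ^ 2) ?_ (Filter.Eventually.of_forall h2)
  exact tendsto_finsetSum _ fun r _ => hasSum_norm_sq _

/-- The minimal norm on `A ⊗ B(ℓ₂)` is dominated by the norm of infinite matrices over `A`. -/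
lemma minNorm_le_spatialNorm (t : A ⊗[ℂ] (EllTwo →L[ℂ] EllTwo)) :
    minNorm t ≤ ENNReal.ofReal (spatialNorm t) := by
  refine iSup_le fun π => iSup_le fun ρ => iSup_le fun ξ => iSup_le fun hξ =>
    ENNReal.ofReal_le_ofReal ?_
  have hbra : ∀ (f k : π.H) (g : ρ.H), braSlice f (π.tensor ρ t (k ⊗ₜ[ℂ] g)) =
      ρ.toHom (vectorSlice π.toHom f k t) g := fun f k g => by
    induction t with
    | zero => simp
    | add x y hx hy => simp [hx, hy]
    | tmul a b => simp [HilbertRep.tensor]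
  obtain ⟨l, f, hf, h1, h2⟩ := exists_orthonormal_legs ξ (π.tensor ρ t ξ)
  set g : Fin l → ρ.H := fun s => braSlice (f s) ξ with hg
  have h3 : ∀ r, braSlice (f r) (π.tensor ρ t ξ) =
      ∑ s, ρ.toHom ((Matrix.of fun r s => vectorSlice π.toHom (f r) (f s) t) r s) (g s) :=
    fun r => by
      conv_lhs => rw [h1]
      simp only [map_sum, hbra, Matrix.of_apply]
      rfl
  have h4 : ‖π.tensor ρ t ξ‖ ^ 2 ≤ spatialNorm t ^ 2 * ‖ξ‖ ^ 2 := by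
    rw [h2, h1, norm_sq_sum_tmul hf, norm_sq_sum_tmul hf, ← h1]
    simp only [h3]
    refine (sum_norm_sq_le_matNorm_of_rep ρ.toHom _ g).trans ?_
    gcongr
    · exact matNorm_nonneg _
    · exact matNorm_vectorSlice_le π.toHom hf t
  have h5 : ‖π.tensor ρ t ξ‖ ≤ spatialNorm t * ‖ξ‖ := by
    refine le_of_sq_le_sq ?_ (mul_nonneg (spatialNorm_nonneg _) (norm_nonneg _))
    rwa [mul_pow]
  exact h5.trans (mul_le_of_le_one_right (spatialNorm_nonneg _) hξ)

/-- If `A` has the LLP, the spatial norm dominates every C*-seminorm on `A ⊗ B(ℓ₂)`. -/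
lemma HasLLP.le_spatialNorm (hA : HasLLP A)
    {p : Seminorm ℂ (A ⊗[ℂ] (EllTwo →L[ℂ] EllTwo))} (hp : IsCStarSeminorm p)
    (t : A ⊗[ℂ] (EllTwo →L[ℂ] EllTwo)) : p t ≤ spatialNorm t := by
  have h : ENNReal.ofReal (p t) ≤ ENNReal.ofReal (spatialNorm t) :=
    calc ENNReal.ofReal (p t) ≤ maxNorm t :=
          le_iSup₂ (f := fun (p : Seminorm ℂ (A ⊗[ℂ] (EllTwo →L[ℂ] EllTwo)))
            (_ : IsCStarSeminorm p) => ENNReal.ofReal (p t)) p hp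
      _ = minNorm t := (hA t).symm
      _ ≤ _ := minNorm_le_spatialNorm t
  exact (ENNReal.ofReal_le_ofReal_iff (spatialNorm_nonneg t)).1 h

end MinNorm

/-! ### Finite dimensional self-adjoint subspaces and approximate morphisms -/

section FDSA

variable {A B : Type*} [NonUnitalCStarAlgebra A] [NonUnitalCStarAlgebra B]

lemma IsFDSA.sup {E F : Submodule ℂ A} (hE : IsFDSA E) (hF : IsFDSA F) : IsFDSA (E ⊔ F) where
  finiteDimensional := by
    have := hE.finiteDimensional
    have := hF.finiteDimensional
    infer_instance
  star_mem x hx := by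
    obtain ⟨y, hy, z, hz, rfl⟩ := Submodule.mem_sup.1 hx
    rw [star_add]
    exact Submodule.add_mem_sup (hE.star_mem y hy) (hF.star_mem z hz)

lemma exists_isFDSA_mem (s : Finset A) : ∃ G : Submodule ℂ A, IsFDSA G ∧ ∀ x ∈ s, x ∈ G := by
  classical
  refine ⟨Submodule.span ℂ (s ∪ s.image star : Finset A), ⟨inferInstance, fun x hx => ?_⟩,
    fun x hx => Submodule.subset_span (by simp [hx])⟩
  induction hx using Submodule.span_induction with
  | mem x hx =>
    refine Submodule.subset_span ?_
    simp only [Finset.coe_union, Finset.coe_image, Set.mem_union, Finset.mem_coe,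
      Set.mem_image] at hx ⊢
    rcases hx with hx | ⟨y, hy, rfl⟩
    · exact .inr ⟨x, hx, rfl⟩
    · exact .inl (by rwa [star_star])
  | zero => simp
  | add x y _ _ hx hy => rw [star_add]; exact add_mem hx hy
  | smul c x _ hx => rw [star_smul]; exact Submodule.smul_mem _ _ hx

lemma IsEpsMorphism.mono {ε ε' : ℝ} (h : ε ≤ ε') {E : Submodule ℂ A} {ψ : E →ₗ[ℂ] B}
    (hψ : IsEpsMorphism ε E ψ) : IsEpsMorphism ε' E ψ where
  norm_le x := (hψ.norm_le x).trans (by gcongr)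
  mul_le x y hxy := (hψ.mul_le x y hxy).trans (by gcongr)
  star_eq := hψ.star_eq

lemma IsFDSA.map {E : Submodule ℂ A} (hE : IsFDSA E) (f : A →ₗ[ℂ] B)
    (hf : ∀ x ∈ E, f (star x) = star (f x)) : IsFDSA (E.map f) where
  finiteDimensional := by
    have := hE.finiteDimensional
    infer_instance
  star_mem x hx := by
    obtain ⟨y, hy, rfl⟩ := hx
    exact ⟨star y, hE.star_mem y hy, hf y hy⟩

lemma IsFDSA.mul {E : Submodule ℂ A} (hE : IsFDSA E) :
    IsFDSA (Submodule.map₂ (LinearMap.mul ℂ A) E E) where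
  finiteDimensional := by
    have h := Module.Finite.iff_fg.1 hE.finiteDimensional
    exact Module.Finite.iff_fg.2 (h.map₂ _ h)
  star_mem x hx := by
    rw [Submodule.map₂_eq_span_image2] at hx ⊢
    induction hx using Submodule.span_induction with
    | mem x hx =>
      obtain ⟨y, hy, z, hz, rfl⟩ := hx
      refine Submodule.subset_span ⟨star z, hE.star_mem z hz, star y, hE.star_mem y hy, ?_⟩
      simp
    | zero => simp
    | add x y _ _ hx hy => rw [star_add]; exact add_mem hx hy
    | smul c x _ hx => rw [star_smul]; exact Submodule.smul_mem _ _ hx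

end FDSA

/-! ### Elements of `A ⊗ B(ℓ₂)` with prescribed matrix -/

section InfiniteMatrix

/-- An infinite matrix with finitely supported rows and uniformly bounded finite corners is the
matrix of an operator on `ℓ₂`. -/
lemma exists_operator_coeff_eq (M : ℕ → ℕ → ℂ) (F : ℕ → Finset ℕ) (hF : ∀ u, ∀ v ∉ F u, M u v = 0)
    {K : ℝ} (hK : 0 ≤ K) (hM : ∀ S : Finset ℕ, matNorm (Matrix.of fun u v : S => M u v) ≤ K) :
    ∃ b : EllTwo →L[ℂ] EllTwo, ∀ u v, coeff u v b = M u v := by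
  -- the bound for finitely many coordinates of the image of `g`
  have key : ∀ (g : EllTwo) (S : Finset ℕ),
      ∑ u ∈ S, ‖∑ v ∈ F u, M u v * g v‖ ^ 2 ≤ (K * ‖g‖) ^ 2 := fun g S => by
    let T : Finset ℕ := S ∪ S.biUnion F
    have hFT : ∀ u ∈ S, ∑ v ∈ F u, M u v * g v = ∑ v ∈ T, M u v * g v := fun u hu =>
      Finset.sum_subset ((Finset.subset_biUnion_of_mem F hu).trans Finset.subset_union_right)
        fun v _ hv => by rw [hF u v hv, zero_mul]
    have h := sum_norm_sq_le_matNorm_scalar (Matrix.of fun u v : T => M u v) (fun v => g v)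
    have h1 : ∀ u : T, ∑ v, (Matrix.of fun u v : T => M u v) u v * g v = ∑ v ∈ T, M u v * g v :=
      fun u => Finset.sum_coe_sort T fun v => M u v * g v
    simp only [h1] at h
    rw [Finset.sum_coe_sort T fun u => ‖∑ v ∈ T, M u v * g v‖ ^ 2,
      Finset.sum_coe_sort T fun u => ‖g u‖ ^ 2] at h
    calc ∑ u ∈ S, ‖∑ v ∈ F u, M u v * g v‖ ^ 2 = ∑ u ∈ S, ‖∑ v ∈ T, M u v * g v‖ ^ 2 :=
          Finset.sum_congr rfl fun u hu => by rw [hFT u hu]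
      _ ≤ ∑ u ∈ T, ‖∑ v ∈ T, M u v * g v‖ ^ 2 :=
          Finset.sum_le_sum_of_subset_of_nonneg Finset.subset_union_left
            fun _ _ _ => by positivity
      _ ≤ _ := h
      _ ≤ K ^ 2 * ‖g‖ ^ 2 := by
          gcongr
          · exact matNorm_nonneg _
          · exact hM T
          · exact sum_norm_sq_le g T
      _ = _ := (mul_pow _ _ _).symm
  let L : EllTwo →ₗ[ℂ] EllTwo :=
    { toFun := fun g => ⟨fun u => ∑ v ∈ F u, M u v * g v,
        memℓp_gen' (C := (K * ‖g‖) ^ 2) (by simpa using key g)⟩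
      map_add' := fun g h => by
        ext u
        change ∑ v ∈ F u, M u v * (g + h : EllTwo) v =
          ∑ v ∈ F u, M u v * g v + ∑ v ∈ F u, M u v * h v
        simp [mul_add, Finset.sum_add_distrib]
      map_smul' := fun c g => by
        ext u
        change ∑ v ∈ F u, M u v * (c • g : EllTwo) v = c * ∑ v ∈ F u, M u v * g v
        simp only [lp.coeFn_smul, Pi.smul_apply, smul_eq_mul, Finset.mul_sum]
        exact Finset.sum_congr rfl fun v _ => by ring }
  refine ⟨L.mkContinuous K fun g => ?_, fun u v => ?_⟩
  · refine lp.norm_le_of_forall_sum_le (by simp) (by positivity) fun S => ?_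
    have h := key g S
    simp only [ENNReal.toReal_ofNat, Real.rpow_ofNat]
    exact h
  · rw [coeff_eq]
    change ∑ w ∈ F u, M u w * (stdVec v : EllTwo) w = M u v
    by_cases hv : v ∈ F u
    · rw [Finset.sum_eq_single v]
      · simp [stdVec]
      · intro w _ hw
        simp [stdVec, Pi.single_eq_of_ne hw]
      · exact fun h => absurd hv h
    · rw [hF u v hv]
      refine Finset.sum_eq_zero fun w hw => ?_
      have hwv : w ≠ v := fun h => hv (h ▸ hw)
      simp [stdVec, Pi.single_eq_of_ne hwv]

end InfiniteMatrix

section Universal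

variable {A D : Type*} [NonUnitalCStarAlgebra A] [NonUnitalCStarAlgebra D]

lemma slice_rTensor (ψ : A →ₗ[ℂ] D) (u v : ℕ) (t : A ⊗[ℂ] (EllTwo →L[ℂ] EllTwo)) :
    slice u v (LinearMap.rTensor (EllTwo →L[ℂ] EllTwo) ψ t) = ψ (slice u v t) := by
  induction t with
  | zero => simp
  | tmul a b => simp
  | add x y hx hy => simp only [map_add, hx, hy]

/-- Every block diagonal infinite matrix with contractive blocks in a finite dimensional subspace
`E` of `A` is the matrix of an element of the unit ball of `A ⊗ B(ℓ₂)`. -/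
lemma exists_tensor_slice_eq (E : Submodule ℂ A) [FiniteDimensional ℂ E] {o : Type*}
    {k : o → ℕ} (X : ∀ p, Matrix (Fin (k p)) (Fin (k p)) E)
    (hX : ∀ p, matNorm ((X p).map fun e => (e : A)) ≤ 1) (e : (Σ p, Fin (k p)) ≃ ℕ) :
    ∃ t : A ⊗[ℂ] (EllTwo →L[ℂ] EllTwo), spatialNorm t ≤ 1 ∧
      ∀ p r s, slice (e ⟨p, r⟩) (e ⟨p, s⟩) t = (X p r s : A) := by
  classical
  let Y : Matrix (Σ p, Fin (k p)) (Σ p, Fin (k p)) E := Matrix.blockDiagonal' X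
  let Z : ℕ → ℕ → E := fun u v => Y (e.symm u) (e.symm v)
  have hZ : ∀ S : Finset ℕ, matNorm ((Matrix.of fun u v : S => Z u v).map fun e => (e : A)) ≤ 1 :=
    fun S => by
    -- the corner on `S` is a corner of the direct sum of the finitely many blocks that meet `S`
    let J : Finset o := S.image fun u => (e.symm u).1
    let f : S ↪ Σ p : J, Fin (k p) :=
      ⟨fun u => ⟨⟨(e.symm u).1, Finset.mem_image_of_mem _ u.2⟩, (e.symm u).2⟩, fun u v huv => by
        have h1 : (e.symm u).1 = (e.symm v).1 := congrArg (fun x : Σ p : J, Fin (k p) => x.1.1) huv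
        have h2 : HEq (e.symm u).2 (e.symm v).2 := by
          simp only [Sigma.mk.injEq] at huv
          exact huv.2
        exact Subtype.ext (e.symm.injective (Sigma.ext h1 h2))⟩
    have h : (Matrix.of fun u v : S => Z u v).map (fun e => (e : A)) =
        (Matrix.blockDiagonal' fun p : J => (X p).map fun e => (e : A)).submatrix f f := by
      ext u v
      simp only [Matrix.map_apply, Matrix.of_apply, Matrix.submatrix_apply, Z, Y,
        Matrix.blockDiagonal'_apply]
      by_cases h1 : (e.symm u).1 = (e.symm v).1
      · rw [dif_pos h1, dif_pos (Subtype.ext h1)]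
        rfl
      · rw [dif_neg h1, dif_neg fun h2 => h1 (congrArg Subtype.val h2)]
        simp
    rw [h]
    exact (matNorm_submatrix_le f _).trans (matNorm_blockDiagonal'_le _ zero_le_one fun p => hX p)
  -- `F u` is the block that contains `u`; expand `Z` in a basis of `E`
  let F : ℕ → Finset ℕ := fun u => Finset.univ.image fun s => e ⟨(e.symm u).1, s⟩
  have hF : ∀ u, ∀ v ∉ F u, Z u v = 0 := fun u v hv => by
    have h1 : (e.symm u).1 ≠ (e.symm v).1 := fun h => hv (by
      refine Finset.mem_image.2 ?_
      rw [h]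
      exact ⟨(e.symm v).2, Finset.mem_univ _, by simp⟩)
    simp only [Z, Y, Matrix.blockDiagonal'_apply, dif_neg h1]
  let c := Module.finBasis ℂ E
  let φ : ∀ i, E →L[ℂ] ℂ := fun i => LinearMap.toContinuousLinearMap (c.coord i)
  have hb : ∀ i, ∃ b : EllTwo →L[ℂ] EllTwo, ∀ u v, coeff u v b = c.coord i (Z u v) := fun i => by
    refine exists_operator_coeff_eq _ F (fun u v hv => by rw [hF u v hv, map_zero])
      (norm_nonneg (φ i)) fun S => ?_
    refine (matNorm_functional_le E (c.coord i) (norm_nonneg (φ i)) (φ i).le_opNorm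
      (Matrix.of fun u v : S => Z u v)).trans ?_
    exact mul_le_of_le_one_right (norm_nonneg _) (hZ S)
  choose b hb using hb
  have ht : ∀ u v, slice u v (∑ i, (c i : A) ⊗ₜ[ℂ] b i) = (Z u v : A) := fun u v => by
    simp only [map_sum, slice_tmul, hb]
    conv_rhs => rw [← c.sum_repr (Z u v)]
    simp only [Submodule.coe_sum, Submodule.coe_smul, Module.Basis.coord_apply]
  refine ⟨∑ i, (c i : A) ⊗ₜ[ℂ] b i, spatialNorm_le fun S => ?_, fun p r s => ?_⟩
  · have h : corner S (∑ i, (c i : A) ⊗ₜ[ℂ] b i) =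
        (Matrix.of fun u v : S => Z u v).map fun e => (e : A) := by
      ext u v
      exact ht u v
    rw [h]
    exact hZ S
  · rw [ht]
    simp only [Z, Y, Equiv.symm_apply_apply, Matrix.blockDiagonal'_apply_eq]

/-- For finite dimensional `E ⊆ A`, there is a single element `t` of the unit ball of
`A ⊗ B(ℓ₂)` such that the norm of `(ψ ⊗ id) t` dominates the c.b. norm of `ψ` on `E`: the direct
sum of a sequence of matrices that is dense in the unit ball of `M_N(E)` for every `N`. -/
lemma exists_tensor_forall_matNorm_map_le (D : Type*) [NonUnitalCStarAlgebra D] (E : Submodule ℂ A)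
    [FiniteDimensional ℂ E] :
    ∃ t : A ⊗[ℂ] (EllTwo →L[ℂ] EllTwo), spatialNorm t ≤ 1 ∧
      ∀ (ψ : A →ₗ[ℂ] D) (N : ℕ) (x : Matrix (Fin N) (Fin N) E),
        matNorm (x.map fun e => ψ e) ≤
          spatialNorm (LinearMap.rTensor (EllTwo →L[ℂ] EllTwo) ψ t) *
            matNorm (x.map fun e => (e : A)) := by
  have : ProperSpace E := FiniteDimensional.proper ℂ E
  let Ball : ℕ → Type _ := fun N =>
    {x : Matrix (Fin N) (Fin N) E // matNorm (x.map fun e => (e : A)) ≤ 1}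
  have hne : ∀ N, Nonempty (Ball N) := fun N => ⟨⟨0, by
    have h : (0 : Matrix (Fin N) (Fin N) E).map (fun e => (e : A)) = 0 := by ext; simp
    rw [h, matNorm_zero]
    exact zero_le_one⟩⟩
  have hsc : ∀ N, SecondCountableTopology (Matrix (Fin N) (Fin N) E) := fun N =>
    inferInstanceAs (SecondCountableTopology (Fin N → Fin N → E))
  have hsep : ∀ N, TopologicalSpace.SeparableSpace (Ball N) := fun N => by
    have h1 := hsc N
    have h2 : SecondCountableTopology (Ball N) :=
      Topology.IsInducing.subtypeVal.secondCountableTopology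
    infer_instance
  let X : ∀ p : ℕ × ℕ, Ball p.1 := fun p => TopologicalSpace.denseSeq (Ball p.1) p.2
  have hinf : Infinite (Σ p : ℕ × ℕ, Fin p.1) :=
    Infinite.of_injective (fun j : ℕ => (⟨(1, j), 0⟩ : Σ p : ℕ × ℕ, Fin p.1)) fun i j h => by
      simpa using congrArg (fun z : Σ p : ℕ × ℕ, Fin p.1 => z.1.2) h
  obtain ⟨e⟩ := nonempty_equiv_of_countable (α := Σ p : ℕ × ℕ, Fin p.1) (β := ℕ)
  obtain ⟨t, ht, hs⟩ := exists_tensor_slice_eq E (fun p => (X p).1) (fun p => (X p).2) e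
  refine ⟨t, ht, fun ψ N => ?_⟩
  set T := LinearMap.rTensor (EllTwo →L[ℂ] EllTwo) ψ t with hT
  have hseq : ∀ p, matNorm ((X p).1.map fun e => ψ e) ≤ spatialNorm T := fun p => by
    let S : Finset ℕ := Finset.univ.image fun r => e ⟨p, r⟩
    let f : Fin p.1 ↪ S := ⟨fun r => ⟨e ⟨p, r⟩, Finset.mem_image_of_mem _ (Finset.mem_univ r)⟩,
      fun r s h => by simpa using congrArg Subtype.val h⟩
    have h : ((X p).1.map fun e => ψ e) = (corner S T).submatrix f f := by
      ext r s
      simp only [Matrix.map_apply, Matrix.submatrix_apply, corner, Matrix.of_apply, hT,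
        slice_rTensor]
      exact congrArg ψ (hs p r s).symm
    rw [h]
    exact (matNorm_submatrix_le f _).trans (matNorm_corner_le S T)
  have hcont : Continuous fun x : Matrix (Fin N) (Fin N) E => matNorm (x.map fun e => ψ e) := by
    have hψ : Continuous fun e : E => ψ e :=
      LinearMap.continuous_of_finiteDimensional (ψ ∘ₗ E.subtype)
    refine continuous_matNorm.comp (continuous_pi fun i => continuous_pi fun j => ?_)
    exact hψ.comp ((continuous_apply j).comp (continuous_apply i))
  have hball : ∀ x : Ball N, matNorm (x.1.map fun e => ψ e) ≤ spatialNorm T := fun x =>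
    (TopologicalSpace.denseRange_denseSeq (Ball N)).induction_on
      (p := fun x : Ball N => matNorm (x.1.map fun e => ψ e) ≤ spatialNorm T) x
      (isClosed_le (hcont.comp continuous_subtype_val) continuous_const) fun j => hseq (N, j)
  intro x
  set c := matNorm (x.map fun e => (e : A)) with hc
  rcases (matNorm_nonneg (x.map fun e => (e : A))).eq_or_lt with h0 | h0
  · have hx : x = 0 := by
      ext i j
      have h1 := norm_entry_le_matNorm (x.map fun e => (e : A)) i j
      rw [← h0] at h1
      simpa using h1
    subst hx
    have h : (0 : Matrix (Fin N) (Fin N) E).map (fun e => ψ e) = 0 := by ext; simp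
    rw [h, matNorm_zero]
    exact mul_nonneg (spatialNorm_nonneg _) (matNorm_nonneg _)
  · rw [← hc] at h0
    have hnorm : ‖((c⁻¹ : ℝ) : ℂ)‖ = c⁻¹ := by
      rw [Complex.norm_real, Real.norm_of_nonneg (inv_nonneg.2 h0.le)]
    have h1 : (((c⁻¹ : ℝ) : ℂ) • x).map (fun e => (e : A)) =
        ((c⁻¹ : ℝ) : ℂ) • x.map fun e => (e : A) := by ext; simp
    have h2 : (((c⁻¹ : ℝ) : ℂ) • x).map (fun e => ψ e) = ((c⁻¹ : ℝ) : ℂ) • x.map fun e => ψ e := by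
      ext; simp
    have h3 := hball ⟨((c⁻¹ : ℝ) : ℂ) • x, by
      rw [h1, matNorm_smul, hnorm, ← hc, inv_mul_cancel₀ h0.ne']⟩
    simp only at h3
    rw [h2, matNorm_smul, hnorm, inv_mul_le_iff₀ h0] at h3
    linarith

end Universal

/-! ### The LLP and approximate complete contractivity -/

section LimitSeminorm

open Filter

variable {A D : Type*} [NonUnitalCStarAlgebra A] [NonUnitalCStarAlgebra D]

lemma tendsto_spatialNorm_mul_sub {ι : Type*} {l : Filter ι} (ψ : ι → A →ₗ[ℂ] D)
    (hmul : ∀ x y, Tendsto (fun i => ‖ψ i (x * y) - ψ i x * ψ i y‖) l (𝓝 0))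
    (s t : A ⊗[ℂ] (EllTwo →L[ℂ] EllTwo)) :
    Tendsto (fun i => spatialSeminorm D (LinearMap.rTensor _ (ψ i) (s * t) -
      LinearMap.rTensor _ (ψ i) s * LinearMap.rTensor _ (ψ i) t)) l (𝓝 0) := by
  induction s with
  | zero =>
    refine tendsto_const_nhds.congr fun i => ?_
    rw [tensor_zero_mul, map_zero, tensor_zero_mul, sub_zero, map_zero]
  | add s s' hs hs' =>
    refine squeeze_zero (fun i => apply_nonneg _ _) (fun i => ?_) (by simpa using hs.add hs')
    refine le_trans (le_of_eq ?_) (map_add_le_add (spatialSeminorm D) _ _)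
    rw [tensor_add_mul, map_add, map_add, tensor_add_mul]
    congr 1
    abel
  | tmul a b =>
    induction t with
    | zero =>
      refine tendsto_const_nhds.congr fun i => ?_
      rw [tensor_mul_zero, map_zero, tensor_mul_zero, sub_zero, map_zero]
    | add t t' ht ht' =>
      refine squeeze_zero (fun i => apply_nonneg _ _) (fun i => ?_) (by simpa using ht.add ht')
      refine le_trans (le_of_eq ?_) (map_add_le_add (spatialSeminorm D) _ _)
      rw [tensor_mul_add, map_add, map_add, tensor_mul_add]
      congr 1
      abel
    | tmul a' b' =>
      refine squeeze_zero (fun i => apply_nonneg _ _) (fun i => ?_)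
        (by simpa using (hmul a a').mul_const ‖b * b'‖)
      rw [Algebra.TensorProduct.tmul_mul_tmul, LinearMap.rTensor_tmul, LinearMap.rTensor_tmul,
        LinearMap.rTensor_tmul, Algebra.TensorProduct.tmul_mul_tmul, ← TensorProduct.sub_tmul]
      exact spatialNorm_tmul_le _ _

lemma eventually_rTensor_star {ι : Type*} {l : Filter ι} (ψ : ι → A →ₗ[ℂ] D)
    (hstar : ∀ x, ∀ᶠ i in l, ψ i (star x) = star (ψ i x)) (t : A ⊗[ℂ] (EllTwo →L[ℂ] EllTwo)) :
    ∀ᶠ i in l, LinearMap.rTensor (EllTwo →L[ℂ] EllTwo) (ψ i) (star t) =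
      star (LinearMap.rTensor (EllTwo →L[ℂ] EllTwo) (ψ i) t) := by
  induction t with
  | zero => simp
  | add s t hs ht =>
    filter_upwards [hs, ht] with i h1 h2
    simp only [star_add, map_add, h1, h2]
  | tmul a b =>
    filter_upwards [hstar a] with i h1
    simp only [TensorProduct.star_tmul, LinearMap.rTensor_tmul, h1]

lemma exists_eventually_spatialNorm_rTensor_le {ι : Type*} {l : Filter ι} (ψ : ι → A →ₗ[ℂ] D)
    (hbd : ∀ x, ∃ K, ∀ᶠ i in l, ‖ψ i x‖ ≤ K) (t : A ⊗[ℂ] (EllTwo →L[ℂ] EllTwo)) :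
    ∃ K, ∀ᶠ i in l, spatialNorm (LinearMap.rTensor (EllTwo →L[ℂ] EllTwo) (ψ i) t) ≤ K := by
  induction t with
  | zero =>
    refine ⟨0, .of_forall fun i => ?_⟩
    rw [map_zero]
    exact (map_zero (spatialSeminorm D)).le
  | add s t hs ht =>
    obtain ⟨K, hK⟩ := hs
    obtain ⟨L, hL⟩ := ht
    refine ⟨K + L, ?_⟩
    filter_upwards [hK, hL] with i h1 h2
    rw [map_add]
    exact (spatialNorm_add_le _ _).trans (add_le_add h1 h2)
  | tmul a b =>
    obtain ⟨K, hK⟩ := hbd a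
    refine ⟨K * ‖b‖, ?_⟩
    filter_upwards [hK] with i h1
    rw [LinearMap.rTensor_tmul]
    exact (spatialNorm_tmul_le _ _).trans (by gcongr)

/-- An asymptotically multiplicative and self-adjoint, pointwise bounded family of linear maps
`A → D` defines a C*-seminorm on `A ⊗ B(ℓ₂)`, along an ultrafilter. -/
lemma exists_isCStarSeminorm_tendsto {ι : Type*} (U : Ultrafilter ι) (ψ : ι → A →ₗ[ℂ] D)
    (hbd : ∀ x, ∃ K, ∀ᶠ i in (U : Filter ι), ‖ψ i x‖ ≤ K)
    (hmul : ∀ x y, Tendsto (fun i => ‖ψ i (x * y) - ψ i x * ψ i y‖) U (𝓝 0))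
    (hstar : ∀ x, ∀ᶠ i in (U : Filter ι), ψ i (star x) = star (ψ i x)) :
    ∃ p : Seminorm ℂ (A ⊗[ℂ] (EllTwo →L[ℂ] EllTwo)), IsCStarSeminorm p ∧
      ∀ t, Tendsto (fun i => spatialNorm (LinearMap.rTensor (EllTwo →L[ℂ] EllTwo) (ψ i) t)) U
        (𝓝 (p t)) := by
  have hlim : ∀ t : A ⊗[ℂ] (EllTwo →L[ℂ] EllTwo), ∃ r : ℝ, Tendsto
      (fun i => spatialNorm (LinearMap.rTensor (EllTwo →L[ℂ] EllTwo) (ψ i) t)) U (𝓝 r) :=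
    fun t => by
    obtain ⟨K, hK⟩ := exists_eventually_spatialNorm_rTensor_le ψ hbd t
    obtain ⟨r, -, hr⟩ := (isCompact_Icc (a := (0 : ℝ)) (b := K)).ultrafilter_le_nhds
      (U.map fun i => spatialNorm (LinearMap.rTensor (EllTwo →L[ℂ] EllTwo) (ψ i) t)) (by
        rw [le_principal_iff]
        exact hK.mono fun i hi => ⟨spatialNorm_nonneg _, hi⟩)
    exact ⟨r, hr⟩
  choose p hp using hlim
  have hadd : ∀ s t, p (s + t) ≤ p s + p t := fun s t =>
    le_of_tendsto_of_tendsto' (hp (s + t)) ((hp s).add (hp t)) fun i => by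
      rw [map_add]
      exact spatialNorm_add_le _ _
  have hsmul : ∀ (c : ℂ) t, p (c • t) ≤ ‖c‖ * p t := fun c t =>
    le_of_tendsto_of_tendsto' (hp (c • t)) ((hp t).const_mul ‖c‖) fun i => by
      rw [map_smul]
      exact spatialNorm_smul_le _ _
  have h0 : p 0 = 0 := by
    refine le_antisymm (by simpa using hsmul 0 0) (ge_of_tendsto' (hp 0) fun i => ?_)
    exact spatialNorm_nonneg _
  have hprod : ∀ s t, Tendsto (fun i => spatialNorm
      (LinearMap.rTensor _ (ψ i) s * LinearMap.rTensor _ (ψ i) t)) U (𝓝 (p (s * t))) :=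
    fun s t => by
    have h1 : Tendsto (fun i => spatialSeminorm D (LinearMap.rTensor _ (ψ i) (s * t)) -
        spatialSeminorm D (LinearMap.rTensor _ (ψ i) s * LinearMap.rTensor _ (ψ i) t)) U (𝓝 0) :=
      squeeze_zero_norm (fun i => abs_sub_map_le_sub (spatialSeminorm D) _ _)
        (tendsto_spatialNorm_mul_sub ψ hmul s t)
    have h2 := (hp (s * t)).sub h1
    rw [sub_zero] at h2
    refine h2.congr fun i => ?_
    exact sub_sub_cancel _ _
  refine ⟨Seminorm.ofSMulLE p h0 hadd hsmul, ⟨fun s t => ?_, fun t => ?_⟩, hp⟩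
  · exact le_of_tendsto_of_tendsto' (hprod s t) ((hp s).mul (hp t))
      fun i => spatialNorm_mul_le _ _
  · refine tendsto_nhds_unique (hprod (star t) t) (((hp t).pow 2).congr' ?_)
    filter_upwards [eventually_rTensor_star ψ hstar t] with i hi
    rw [hi]
    exact (isCStarSeminorm_spatialSeminorm.star_mul_self _).symm

/-- If `A` has the LLP, then `ε`-morphisms on large enough finite dimensional subspaces are almost
completely contractive on a given one. Otherwise the counterexamples, indexed by the larger
subspaces and by the errors, define in the limit a C*-seminorm on `A ⊗ B(ℓ₂)` that exceeds the
spatial norm at the universal element `t`. -/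
lemma HasLLP.exists_forall_matNorm_map_le (hA : HasLLP A) (D : Type*) [NonUnitalCStarAlgebra D]
    {E : Submodule ℂ A} (hE : IsFDSA E) {e : ℝ} (he : 0 < e) :
    ∃ (G : Submodule ℂ A) (hEG : E ≤ G), IsFDSA G ∧ ∃ η : ℝ, 0 < η ∧
      ∀ ψ : G →ₗ[ℂ] D, IsEpsMorphism η G ψ → ∀ (N : ℕ) (x : Matrix (Fin N) (Fin N) E),
        matNorm (x.map fun y => ψ (Submodule.inclusion hEG y)) ≤
          (1 + e) * matNorm (x.map fun y => (y : A)) := by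
  have := hE.finiteDimensional
  obtain ⟨t, ht, htψ⟩ := exists_tensor_forall_matNorm_map_le D E
  by_contra! hcon
  let ι := {G : Submodule ℂ A // E ≤ G ∧ IsFDSA G} × ℕ
  have hdir : IsDirectedOrder ι := ⟨fun i j =>
    ⟨⟨⟨i.1.1 ⊔ j.1.1, i.1.2.1.trans le_sup_left, i.1.2.2.sup j.1.2.2⟩, i.2 ⊔ j.2⟩,
      ⟨(le_sup_left : i.1.1 ≤ i.1.1 ⊔ j.1.1), le_sup_left⟩,
      ⟨(le_sup_right : j.1.1 ≤ i.1.1 ⊔ j.1.1), le_sup_right⟩⟩⟩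
  have hne : Nonempty ι := ⟨⟨⟨E, le_rfl, hE⟩, 0⟩⟩
  have hψ : ∀ i : ι, ∃ ψ : A →ₗ[ℂ] D,
      IsEpsMorphism (1 / ((i.2 : ℝ) + 1)) i.1.1 (ψ ∘ₗ i.1.1.subtype) ∧
      1 + e < spatialNorm (LinearMap.rTensor (EllTwo →L[ℂ] EllTwo) ψ t) := fun i => by
    obtain ⟨ψ, hψ, N, x, hx⟩ := hcon i.1.1 i.1.2.1 i.1.2.2 (1 / ((i.2 : ℝ) + 1)) (by positivity)
    obtain ⟨ψ', hψ'⟩ := ψ.exists_extend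
    refine ⟨ψ', by rwa [hψ'], ?_⟩
    have h1 : (fun y : E => ψ (Submodule.inclusion i.1.2.1 y)) = fun y : E => ψ' y := by
      rw [← hψ']; rfl
    rw [h1] at hx
    exact lt_of_mul_lt_mul_right (hx.trans_le (htψ ψ' N x)) (matNorm_nonneg _)
  choose ψ hψ hlt using hψ
  have hbot : (atTop : Filter ι).NeBot := atTop_neBot
  let U : Ultrafilter ι := Ultrafilter.of atTop
  have hU : (U : Filter ι) ≤ atTop := Ultrafilter.of_le _
  have hmem : ∀ s : Finset A, ∀ᶠ i in (U : Filter ι), ∀ x ∈ s, x ∈ i.1.1 := fun s => by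
    obtain ⟨G, hG, hs⟩ := exists_isFDSA_mem s
    refine hU ?_
    filter_upwards [eventually_ge_atTop
      ((⟨⟨E ⊔ G, le_sup_left, hE.sup hG⟩, 0⟩ : ι))] with i hi x hx
    exact (le_sup_right.trans (show E ⊔ G ≤ i.1.1 from hi.1)) (hs x hx)
  have hsmall : Tendsto (fun i : ι => 1 / ((i.2 : ℝ) + 1)) U (𝓝 0) := by
    have h1 : Tendsto (fun i : ι => i.2) atTop atTop :=
      tendsto_atTop.2 fun n => by
        filter_upwards [eventually_ge_atTop ((⟨⟨E, le_rfl, hE⟩, n⟩ : ι))] with i hi using hi.2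
    exact (tendsto_one_div_add_atTop_nhds_zero_nat.comp h1).mono_left hU
  obtain ⟨p, hp, hpt⟩ := exists_isCStarSeminorm_tendsto U ψ
    (fun x => ⟨2 * ‖x‖, by
      filter_upwards [hmem {x}] with i hi
      have h1 := (hψ i).norm_le ⟨x, hi x (by simp)⟩
      refine h1.trans ?_
      have h2 : 1 / ((i.2 : ℝ) + 1) ≤ 1 := by
        rw [div_le_one (by positivity)]
        linarith [(Nat.cast_nonneg i.2 : (0 : ℝ) ≤ i.2)]
      change (1 + _) * ‖x‖ ≤ _
      gcongr
      linarith⟩)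
    (fun x y => by
      classical
      refine squeeze_zero' (.of_forall fun i => norm_nonneg _) ?_
        (by simpa only [zero_mul] using (hsmall.mul_const ‖x‖).mul_const ‖y‖)
      filter_upwards [hmem {x, y, x * y}] with i hi
      exact (hψ i).mul_le ⟨x, hi x (by simp)⟩ ⟨y, hi y (by simp)⟩ (hi (x * y) (by simp)))
    (fun x => by
      filter_upwards [hmem {x}] with i hi
      have hx := hi x (by simp)
      exact (hψ i).star_eq ⟨x, hx⟩ (i.1.2.2.star_mem x hx))
  have h1 : 1 + e ≤ p t := ge_of_tendsto' (hpt t) fun i => (hlt i).le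
  have h2 := hA.le_spatialNorm hp t
  linarith

end LimitSeminorm

/-! ### Matrices over `ℓ_∞/c_0` -/

section CoronaMatrix

open Filter

variable {C : ℕ → Type*} [∀ k, NonUnitalCStarAlgebra (C k)] {n : Type*} [Fintype n]

lemma Corona.eventually_norm_lt {x : lp C ∞} {r : ℝ} (h : ‖Corona.mk x‖ < r) :
    ∀ᶠ k in atTop, ‖x k‖ < r := by
  obtain ⟨z, hz, hzn⟩ := Corona.exists_rep (Corona.mk x) (half_pos (sub_pos.2 h))
  have h0 := mem_cZero.1 (Corona.mk_eq_mk.1 hz.symm)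
  filter_upwards [h0.eventually_lt_const (half_pos (sub_pos.2 h))] with k hk
  have h2 : ‖z k‖ ≤ ‖z‖ := lp.norm_apply_le_norm ENNReal.top_ne_zero z k
  have h3 : ‖x k‖ ≤ ‖(x - z) k‖ + ‖z k‖ := by
    have h4 : x k = (x - z) k + z k := by
      change _ = (x k - z k) + z k
      abel
    rw [h4]
    exact norm_add_le _ _
  linarith

/-- A crude bound for the norm of a matrix, uniform over all C*-algebras. -/
lemma matNorm_le_sum [DecidableEq n] {A : Type*} [NonUnitalCStarAlgebra A] (X : Matrix n n A) :
    matNorm X ≤ ∑ i, ∑ j, matNorm (Matrix.single i j (1 : ℂ)) * ‖X i j‖ := by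
  have h : X = ∑ i, ∑ j, (Matrix.single i j (1 : ℂ)).map fun z => z • X i j := by
    conv_lhs => rw [Matrix.matrix_eq_sum_single X]
    refine Finset.sum_congr rfl fun i _ => Finset.sum_congr rfl fun j _ => ?_
    ext r s
    simp only [Matrix.map_apply, Matrix.single_apply]
    split_ifs <;> simp
  conv_lhs => rw [h]
  refine (matNorm_sum_le _ _).trans (Finset.sum_le_sum fun i _ => ?_)
  exact (matNorm_sum_le _ _).trans (Finset.sum_le_sum fun j _ => matNorm_tensor_le _ _)

section Abstract

variable {M : ℕ → Type*} [∀ k, NonUnitalCStarAlgebra (M k)]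
  (e : ∀ k, Matrix n n (C k) →⋆ₙₐ[ℂ] M k) (he : ∀ k, Function.Injective (e k))

include he in
lemma memℓp_matrixSeq (X : Matrix n n (lp C ∞)) :
    Memℓp (fun k => e k (X.map fun x => x k)) ∞ := by
  classical
  refine memℓp_infty ⟨∑ i, ∑ j, matNorm (Matrix.single i j (1 : ℂ)) * ‖X i j‖, ?_⟩
  rintro _ ⟨k, rfl⟩
  simp only [norm_starHom_eq_matNorm (e k) (he k)]
  refine (matNorm_le_sum (X.map fun x => x k)).trans ?_
  gcongr with i _ j _
  · exact matNorm_nonneg _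
  · exact lp.norm_apply_le_norm ENNReal.top_ne_zero (X i j) k

/-- A matrix of bounded sequences, as a bounded sequence of matrices. The matrix algebras are
represented by arbitrary C*-algebras `M k`, by means of the embeddings `e k`. -/
def matrixSeq (X : Matrix n n (lp C ∞)) : lp M ∞ :=
  ⟨fun k => e k (X.map fun x => x k), memℓp_matrixSeq e he X⟩

lemma norm_matrixSeq_apply (X : Matrix n n (lp C ∞)) (k : ℕ) :
    ‖matrixSeq e he X k‖ = matNorm (X.map fun x => x k) :=
  norm_starHom_eq_matNorm (e k) (he k) _

lemma matrixSeq_add (X Y : Matrix n n (lp C ∞)) :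
    matrixSeq e he (X + Y) = matrixSeq e he X + matrixSeq e he Y := by
  ext k
  exact map_add (e k) (X.map fun x => x k) (Y.map fun x => x k)

lemma matrixSeq_smul (c : ℂ) (X : Matrix n n (lp C ∞)) :
    matrixSeq e he (c • X) = c • matrixSeq e he X := by
  ext k
  exact map_smul (e k) c (X.map fun x => x k)

lemma matrixSeq_mul (X Y : Matrix n n (lp C ∞)) :
    matrixSeq e he (X * Y) = matrixSeq e he X * matrixSeq e he Y := by
  ext k
  refine Eq.trans (congrArg (e k) ?_) (map_mul (e k) (X.map fun x => x k) (Y.map fun x => x k))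
  ext i j
  simp only [Matrix.map_apply, Matrix.mul_apply]
  rw [lp.coeFn_sum, Finset.sum_apply]
  rfl

lemma matrixSeq_conjTranspose (X : Matrix n n (lp C ∞)) :
    matrixSeq e he X.conjTranspose = star (matrixSeq e he X) := by
  ext k
  exact map_star (e k) (X.map fun x => x k)

lemma mk_matrixSeq_eq_iff (X Y : Matrix n n (lp C ∞)) :
    Corona.mk (matrixSeq e he X) = Corona.mk (matrixSeq e he Y) ↔
      X.map Corona.mk = Y.map Corona.mk := by
  classical
  have h : ∀ k, ‖(matrixSeq e he X - matrixSeq e he Y) k‖ = matNorm ((X - Y).map fun x => x k) :=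
    fun k => by
    rw [← norm_matrixSeq_apply e he]
    congr 1
    exact (map_sub (e k) (X.map fun x => x k) (Y.map fun x => x k)).symm
  rw [Corona.mk_eq_mk, mem_cZero]
  simp only [h]
  refine ⟨fun hXY => ?_, fun hXY => ?_⟩
  · ext i j
    refine Corona.mk_eq_mk.2 (mem_cZero.2 (squeeze_zero (fun k => norm_nonneg _) (fun k => ?_) hXY))
    exact norm_entry_le_matNorm ((X - Y).map fun x => x k) i j
  · refine squeeze_zero (fun k => matNorm_nonneg _) (fun k => matNorm_le_sum _) ?_
    have h0 : ∀ i j, Tendsto (fun k => ‖((X - Y).map fun x => x k) i j‖) atTop (𝓝 0) :=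
      fun i j => mem_cZero.1 (Corona.mk_eq_mk.1 (congrFun (congrFun hXY i) j))
    have h1 := tendsto_finsetSum (Finset.univ : Finset n) fun i _ =>
      tendsto_finsetSum (Finset.univ : Finset n) fun j _ =>
        (h0 i j).const_mul (matNorm (Matrix.single i j (1 : ℂ)))
    simpa using h1

/-- The identification of matrices over `ℓ_∞/c_0` with elements of `ℓ_∞/c_0` of the matrix
algebras. -/
def matrixCoronaFun (X : Matrix n n (Corona C)) : Corona M :=
  Corona.mk (matrixSeq e he (X.map (Function.surjInv Corona.mk_surjective)))

lemma matrixCoronaFun_map_mk (X : Matrix n n (lp C ∞)) :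
    matrixCoronaFun e he (X.map Corona.mk) = Corona.mk (matrixSeq e he X) := by
  refine (mk_matrixSeq_eq_iff e he _ _).2 ?_
  ext i j
  exact Function.surjInv_eq Corona.mk_surjective _

lemma exists_map_mk_eq {n : Type*} (X : Matrix n n (Corona C)) :
    ∃ Y : Matrix n n (lp C ∞), Y.map Corona.mk = X :=
  ⟨X.map (Function.surjInv Corona.mk_surjective), by
    ext i j
    exact Function.surjInv_eq Corona.mk_surjective _⟩

/-- The map `matrixCoronaFun` as a `*`-homomorphism. -/
def matrixCorona : Matrix n n (Corona C) →⋆ₙₐ[ℂ] Corona M where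
  toFun := matrixCoronaFun e he
  map_smul' c X := by
    obtain ⟨X, rfl⟩ := exists_map_mk_eq X
    have h : c • X.map Corona.mk = (c • X).map Corona.mk := by ext; simp
    rw [h, matrixCoronaFun_map_mk, matrixCoronaFun_map_mk, matrixSeq_smul]
    exact map_smul Corona.mk c (matrixSeq e he X)
  map_zero' := by
    have h : (0 : Matrix n n (Corona C)) = ((0 : ℂ) • (0 : Matrix n n (lp C ∞))).map Corona.mk := by
      ext; simp
    rw [h, matrixCoronaFun_map_mk, matrixSeq_smul, zero_smul, map_zero]
  map_add' X Y := by
    obtain ⟨X, rfl⟩ := exists_map_mk_eq X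
    obtain ⟨Y, rfl⟩ := exists_map_mk_eq Y
    have h : X.map Corona.mk + Y.map Corona.mk = (X + Y).map Corona.mk := by ext; simp
    rw [h, matrixCoronaFun_map_mk, matrixCoronaFun_map_mk, matrixCoronaFun_map_mk, matrixSeq_add,
      map_add]
  map_mul' X Y := by
    obtain ⟨X, rfl⟩ := exists_map_mk_eq X
    obtain ⟨Y, rfl⟩ := exists_map_mk_eq Y
    have h : X.map Corona.mk * Y.map Corona.mk = (X * Y).map Corona.mk := by
      ext i j
      simp [Matrix.mul_apply, Corona.mk_mul]
    rw [h, matrixCoronaFun_map_mk, matrixCoronaFun_map_mk, matrixCoronaFun_map_mk, matrixSeq_mul,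
      Corona.mk_mul]
  map_star' X := by
    obtain ⟨X, rfl⟩ := exists_map_mk_eq X
    have h : star (X.map Corona.mk) = X.conjTranspose.map Corona.mk := by
      ext i j
      simp [Matrix.star_apply, Corona.mk_star]
    rw [h, matrixCoronaFun_map_mk, matrixCoronaFun_map_mk, ← Corona.mk_star,
      matrixSeq_conjTranspose]

/-- `matrixCorona` is injective, hence isometric. -/
lemma norm_mk_matrixSeq (X : Matrix n n (lp C ∞)) :
    ‖Corona.mk (matrixSeq e he X)‖ = matNorm (X.map Corona.mk) := by
  rw [← matrixCoronaFun_map_mk]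
  refine norm_starHom_eq_matNorm (matrixCorona e he) (fun X Y h => ?_) _
  obtain ⟨X, rfl⟩ := exists_map_mk_eq X
  obtain ⟨Y, rfl⟩ := exists_map_mk_eq Y
  refine (mk_matrixSeq_eq_iff e he X Y).1 ?_
  rw [← matrixCoronaFun_map_mk, ← matrixCoronaFun_map_mk]
  exact h

include e he in
lemma matNorm_map_mk_le_of_embeddings {X : Matrix n n (lp C ∞)} {r : ℝ} (hr : 0 ≤ r)
    (h : ∀ᶠ k in atTop, matNorm (X.map fun x => x k) ≤ r) : matNorm (X.map Corona.mk) ≤ r := by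
  rw [← norm_mk_matrixSeq e he]
  refine Corona.norm_mk_le_of_eventually hr ?_
  simpa only [norm_matrixSeq_apply] using h

include e he in
lemma le_matNorm_map_mk_of_embeddings {X : Matrix n n (lp C ∞)} {r : ℝ}
    (h : ∀ᶠ k in atTop, r ≤ matNorm (X.map fun x => x k)) : r ≤ matNorm (X.map Corona.mk) := by
  rw [← norm_mk_matrixSeq e he]
  by_contra! hlt
  obtain ⟨k, h1, h2⟩ := (h.and (Corona.eventually_norm_lt hlt)).exists
  rw [norm_matrixSeq_apply] at h2
  exact absurd h2 (not_lt.2 h1)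

end Abstract

section

attribute [local instance] CStarAlgebra.spectralOrder CStarAlgebra.spectralOrderedRing

lemma matNorm_map_mk_le {X : Matrix n n (lp C ∞)} {r : ℝ} (hr : 0 ≤ r)
    (h : ∀ᶠ k in atTop, matNorm (X.map fun x => x k) ≤ r) : matNorm (X.map Corona.mk) ≤ r :=
  matNorm_map_mk_le_of_embeddings (M := fun k => CStarMatrix n n (C k))
    (fun k => NonUnitalStarAlgHom.id ℂ (CStarMatrix n n (C k))) (fun _ _ _ h => h) hr h

lemma le_matNorm_map_mk {X : Matrix n n (lp C ∞)} {r : ℝ}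
    (h : ∀ᶠ k in atTop, r ≤ matNorm (X.map fun x => x k)) : r ≤ matNorm (X.map Corona.mk) :=
  le_matNorm_map_mk_of_embeddings (M := fun k => CStarMatrix n n (C k))
    (fun k => NonUnitalStarAlgHom.id ℂ (CStarMatrix n n (C k))) (fun _ _ _ h => h) h

end

end CoronaMatrix

/-! ### Lifting almost completely isometrically -/

section Step

variable {A B D : Type*} [NonUnitalCStarAlgebra A] [NonUnitalCStarAlgebra B]
  [NonUnitalCStarAlgebra D]

/-- Given an isometric `i : A → B` and a quotient map `q : D → B` that almost allows liftings,
where `A` has the LLP, a finite dimensional `E ⊆ A` has an almost completely isometric, almost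
multiplicative map into `D`, obtained by lifting a large finite dimensional subspace of `B`. The
lower bound holds because `q ∘ ψ` is close to the identity and `E` is finite dimensional. -/
lemma exists_lifting (hA : HasLLP A) (i : A →⋆ₙₐ[ℂ] B) (hi : Isometry i) (q : D →⋆ₙₐ[ℂ] B)
    (hq : AlmostAllowsLiftings q) {E : Submodule ℂ A} (hE : IsFDSA E) {G : Submodule ℂ B}
    (hG : IsFDSA G) {τ : ℝ} (hτ : 0 < τ) (hτ1 : τ ≤ 1) :
    ∃ (F : Submodule ℂ B) (ψ : B →ₗ[ℂ] D), IsFDSA F ∧ G ≤ F ∧ (∀ x ∈ E, i x ∈ F) ∧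
      IsEpsMorphism τ F (ψ ∘ₗ F.subtype) ∧
      ∀ (N : ℕ) (x : Matrix (Fin N) (Fin N) A), (∀ r s, x r s ∈ E) →
        matNorm (x.map fun a => ψ (i a)) ≤ (1 + τ) * matNorm x ∧
        matNorm x ≤ (1 + τ) * matNorm (x.map fun a => ψ (i a)) := by
  have := hE.finiteDimensional
  have hnorm : ∀ a, ‖i a‖ = ‖a‖ := hi.norm_map_of_map_zero (map_zero i)
  obtain ⟨G', hEG', hG', η₁, hη₁, hcb⟩ := hA.exists_forall_matNorm_map_le D hE hτ
  obtain ⟨K, hK, hKu⟩ := exists_matNorm_map_le (B := B) E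
  let F : Submodule ℂ B := G ⊔ G'.map (i : A →ₗ[ℂ] B)
  have hF : IsFDSA F := hG.sup (hG'.map _ fun x _ => map_star i x)
  have hiF : ∀ x ∈ G', i x ∈ F := fun x hx =>
    (le_sup_right : G'.map (i : A →ₗ[ℂ] B) ≤ F) (Submodule.mem_map_of_mem hx)
  let η : ℝ := min τ (min η₁ (τ / (2 * K)))
  have hη : 0 < η := by positivity
  obtain ⟨ψ₀, hψ₀, hqψ⟩ := hq η hη F hF
  obtain ⟨ψ, rfl⟩ := ψ₀.exists_extend
  refine ⟨F, ψ, hF, le_sup_left, fun x hx => hiF x (hEG' hx), hψ₀.mono (min_le_left _ _),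
    fun N x hx => ?_⟩
  let y : Matrix (Fin N) (Fin N) E := Matrix.of fun r s => ⟨x r s, hx r s⟩
  have hy : y.map (fun e => (e : A)) = x := rfl
  constructor
  -- the upper bound, from the LLP of `A`
  · let χ : G' →ₗ[ℂ] D := ψ ∘ₗ (i : A →ₗ[ℂ] B) ∘ₗ G'.subtype
    have hχ : IsEpsMorphism η₁ G' χ := by
      refine IsEpsMorphism.mono ((min_le_right _ _).trans (min_le_left _ _) : η ≤ η₁) ⟨fun a => ?_,
        fun a b hab => ?_, fun a ha => ?_⟩
      · have h := hψ₀.norm_le ⟨i a, hiF a a.2⟩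
        refine h.trans (le_of_eq ?_)
        change _ * ‖i a‖ = _ * ‖(a : A)‖
        rw [hnorm]
      · have h := hψ₀.mul_le ⟨i a, hiF a a.2⟩ ⟨i b, hiF b b.2⟩
          (by rw [← map_mul]; exact hiF _ hab)
        refine le_trans (le_of_eq ?_) (h.trans (le_of_eq ?_))
        · change ‖ψ (i (a * b : A)) - _‖ = ‖ψ (i a * i b) - _‖
          rw [map_mul]
          rfl
        · change _ * ‖i a‖ * ‖i b‖ = _ * ‖(a : A)‖ * ‖(b : A)‖
          rw [hnorm, hnorm]
      · have h := hψ₀.star_eq ⟨i a, hiF a a.2⟩ (by rw [← map_star]; exact hiF _ ha)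
        refine Eq.trans ?_ h
        change ψ (i (star (a : A))) = ψ (star (i a))
        rw [map_star]
    exact hcb χ hχ N y
  -- the lower bound: the defect `u = (q ∘ ψ - id) ∘ i` has norm at most `η`, hence small c.b. norm
  · let u : E →ₗ[ℂ] B := ((q : D →ₗ[ℂ] B) ∘ₗ ψ ∘ₗ (i : A →ₗ[ℂ] B) - (i : A →ₗ[ℂ] B)) ∘ₗ E.subtype
    have hu : ∀ a : E, ‖u a‖ ≤ η * ‖a‖ := fun a => by
      have h := hqψ ⟨i a, hiF a (hEG' a.2)⟩
      refine h.trans (le_of_eq ?_)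
      change _ * ‖i a‖ = _ * ‖(a : A)‖
      rw [hnorm]
    have h1 := hKu u η hη.le hu N y
    rw [hy] at h1
    have h2 : x.map i = (x.map fun a => ψ (i a)).map q + (-1 : ℂ) • y.map u := by
      ext r s
      simp only [Matrix.map_apply, Matrix.add_apply, neg_smul, one_smul]
      change i (x r s) = q (ψ (i (x r s))) + -(q (ψ (i (x r s))) - i (x r s))
      abel
    have hx0 := matNorm_nonneg x
    have h3 : matNorm x ≤ matNorm (x.map fun a => ψ (i a)) + τ / 2 * matNorm x := by
      calc matNorm x = matNorm (x.map i) := (matNorm_map_eq i hi.injective x).symm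
        _ ≤ matNorm ((x.map fun a => ψ (i a)).map q) + matNorm ((-1 : ℂ) • y.map u) := by
            rw [h2]
            exact matNorm_add_le _ _
        _ ≤ matNorm (x.map fun a => ψ (i a)) + η * K * matNorm x := by
            rw [matNorm_smul, norm_neg, norm_one, one_mul]
            exact add_le_add (matNorm_map_le q _) h1
        _ ≤ _ := by
            gcongr
            calc η * K ≤ τ / (2 * K) * K := by
                  gcongr
                  exact (min_le_right _ _).trans (min_le_right _ _)
              _ = τ / 2 := by field_simp
    nlinarith [mul_nonneg hτ.le hx0, mul_nonneg (sub_nonneg.2 hτ1) hx0,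
      mul_nonneg hτ.le (mul_nonneg (sub_nonneg.2 hτ1) hx0)]

end Step

/-! ### Approximate inductive systems and their limits in `ℓ_∞/c_0` -/

section Construction

open Filter

lemma exists_dependent_seq {S : ℕ → Type*} (s₀ : S 0) {P : ∀ n, S n → S (n + 1) → Prop}
    (h : ∀ n s, ∃ t, P n s t) : ∃ s : ∀ n, S n, ∀ n, P n (s n) (s (n + 1)) := by
  choose t ht using h
  exact ⟨fun n => Nat.rec s₀ (fun n s => t n s) n, fun n => ht n _⟩

lemma cbNorm_le_ofReal {A D : Type*} [NonUnitalCStarAlgebra A] [NonUnitalCStarAlgebra D]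
    {E : Submodule ℂ A} {F : Submodule ℂ D} (u : E →ₗ[ℂ] F) {c : ℝ} (hc : 0 ≤ c)
    (h : ∀ (N : ℕ) (x : Matrix (Fin N) (Fin N) E),
      matNorm (x.map fun e => (u e : D)) ≤ c * matNorm (x.map fun e => (e : A))) :
    cbNorm u ≤ ENNReal.ofReal c := by
  refine iSup_le fun N => iSup_le fun x => iSup_le fun hx => ENNReal.ofReal_le_ofReal ?_
  exact (h N x).trans (mul_le_of_le_one_right hc hx)

/-- An inductive system of finite dimensional self-adjoint subspaces `E n` of C*-algebras `C n`,
with connecting maps that are almost completely isometric and almost multiplicative, the errors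
`τ n` being small and at least halved in every step. The connecting maps matter on `E n` only; they
are defined on all of `C n`, so that they compose without coercions. By `mul_mem` the products
of the images of elements of `E n` lie in `E (n + 1)`. -/
structure ApproxSystem (C : ℕ → Type*) [∀ n, NonUnitalCStarAlgebra (C n)] where
  E : ∀ n, Submodule ℂ (C n)
  Φ : ∀ n, C n →ₗ[ℂ] C (n + 1)
  τ : ℕ → ℝ
  isFDSA : ∀ n, IsFDSA (E n)
  τ_pos : ∀ n, 0 < τ n
  τ_le : ∀ n, τ n ≤ 1 / 100
  τ_succ_le : ∀ n, τ (n + 1) ≤ τ n / 2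
  map_mem : ∀ n, ∀ x ∈ E n, Φ n x ∈ E (n + 1)
  mul_mem : ∀ n, ∀ x ∈ E n, ∀ y ∈ E n, Φ n x * Φ n y ∈ E (n + 1)
  norm_le : ∀ n, ∀ x ∈ E n, ‖Φ n x‖ ≤ (1 + τ n) * ‖x‖
  mul_le : ∀ n, ∀ x ∈ E n, ∀ y ∈ E n, x * y ∈ E n →
    ‖Φ n (x * y) - Φ n x * Φ n y‖ ≤ τ n * ‖x‖ * ‖y‖
  map_star : ∀ n, ∀ x ∈ E n, Φ n (star x) = star (Φ n x)
  matNorm_map_le : ∀ n (N : ℕ) (x : Matrix (Fin N) (Fin N) (C n)), (∀ r s, x r s ∈ E n) →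
    matNorm (x.map (Φ n)) ≤ (1 + τ n) * matNorm x
  le_matNorm_map : ∀ n (N : ℕ) (x : Matrix (Fin N) (Fin N) (C n)), (∀ r s, x r s ∈ E n) →
    matNorm x ≤ (1 + τ n) * matNorm (x.map (Φ n))

namespace ApproxSystem

variable {C : ℕ → Type*} [∀ n, NonUnitalCStarAlgebra (C n)] (S : ApproxSystem C)

/-- The composition `C n → C (n + 1) → ⋯ → C m` of connecting maps. -/
def trans {n m : ℕ} (h : n ≤ m) : C n →ₗ[ℂ] C m :=
  Nat.leRecOn (C := fun k => C n →ₗ[ℂ] C k) h (fun {k} f => S.Φ k ∘ₗ f) LinearMap.id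

lemma trans_self (n : ℕ) : S.trans (le_refl n) = LinearMap.id := Nat.leRecOn_self _

lemma trans_succ {n m : ℕ} (h : n ≤ m) (x : C n) :
    S.trans (Nat.le_succ_of_le h) x = S.Φ m (S.trans h x) := by
  have := Nat.leRecOn_succ (C := fun k => C n →ₗ[ℂ] C k) h
    (h2 := Nat.le_succ_of_le h) (next := fun {k} f => S.Φ k ∘ₗ f) LinearMap.id
  exact congrArg (fun f : C n →ₗ[ℂ] C (m + 1) => f x) this

lemma trans_Φ {n m : ℕ} (h : n + 1 ≤ m) (x : C n) :
    S.trans h (S.Φ n x) = S.trans ((Nat.le_succ n).trans h) x := by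
  induction m, h using Nat.le_induction with
  | base => rw [trans_self, trans_succ S (le_refl n), trans_self]; rfl
  | succ m h ih => rw [S.trans_succ h, S.trans_succ ((Nat.le_succ n).trans h), ih]

lemma trans_mem {n m : ℕ} (h : n ≤ m) {x : C n} (hx : x ∈ S.E n) : S.trans h x ∈ S.E m := by
  induction m, h using Nat.le_induction with
  | base => rw [trans_self]; exact hx
  | succ m h ih => rw [S.trans_succ h]; exact S.map_mem m _ ih

lemma τ_le_of_le {n m : ℕ} (h : n ≤ m) : S.τ m ≤ S.τ n := by
  induction m, h using Nat.le_induction with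
  | base => exact le_rfl
  | succ m h ih => linarith [S.τ_succ_le m, S.τ_pos m]

lemma tendsto_τ : Tendsto S.τ atTop (𝓝 0) := by
  have h : ∀ n, S.τ n ≤ (1 / 2) ^ n := fun n => by
    induction n with
    | zero => exact (S.τ_le 0).trans (by norm_num)
    | succ n ih =>
      rw [pow_succ]
      linarith [S.τ_succ_le n]
  exact squeeze_zero (fun n => (S.τ_pos n).le) h
    (tendsto_pow_atTop_nhds_zero_of_lt_one (by norm_num) (by norm_num))

/-- The telescoping estimate for the products of the factors `1 + τ k`. -/
lemma telescope {n m : ℕ} (h : n ≤ m) :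
    (1 + 4 * (S.τ n - S.τ m)) * (1 + S.τ m) ≤ 1 + 4 * (S.τ n - S.τ (m + 1)) := by
  nlinarith [S.τ_le_of_le h, S.τ_le n, S.τ_pos m, S.τ_succ_le m, S.τ_pos n, S.τ_le m]

lemma norm_trans_le {n m : ℕ} (h : n ≤ m) {x : C n} (hx : x ∈ S.E n) :
    ‖S.trans h x‖ ≤ (1 + 4 * (S.τ n - S.τ m)) * ‖x‖ := by
  induction m, h using Nat.le_induction with
  | base => simp [trans_self]
  | succ m h ih =>
    rw [S.trans_succ h]
    have := S.τ_pos m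
    calc ‖S.Φ m (S.trans h x)‖ ≤ (1 + S.τ m) * ‖S.trans h x‖ := S.norm_le m _ (S.trans_mem h hx)
      _ ≤ (1 + S.τ m) * ((1 + 4 * (S.τ n - S.τ m)) * ‖x‖) := by gcongr
      _ = ((1 + 4 * (S.τ n - S.τ m)) * (1 + S.τ m)) * ‖x‖ := by ring
      _ ≤ _ := by gcongr; exact S.telescope h

lemma norm_trans_le' {n m : ℕ} (h : n ≤ m) {x : C n} (hx : x ∈ S.E n) :
    ‖S.trans h x‖ ≤ (1 + 4 * S.τ n) * ‖x‖ :=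
  (S.norm_trans_le h hx).trans (by gcongr; linarith [S.τ_pos m])

lemma trans_star {n m : ℕ} (h : n ≤ m) {x : C n} (hx : x ∈ S.E n) :
    S.trans h (star x) = star (S.trans h x) := by
  induction m, h using Nat.le_induction with
  | base => simp [trans_self]
  | succ m h ih => rw [S.trans_succ h, S.trans_succ h, ih, S.map_star m _ (S.trans_mem h hx)]

lemma trans_mul_trans_mem {n m : ℕ} (h : n < m) {x y : C n} (hx : x ∈ S.E n) (hy : y ∈ S.E n) :
    S.trans h.le x * S.trans h.le y ∈ S.E m := by
  obtain ⟨m, rfl⟩ : ∃ k, m = k + 1 := ⟨m - 1, by omega⟩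
  have h' : n ≤ m := Nat.lt_succ_iff.1 h
  rw [S.trans_succ h', S.trans_succ h']
  exact S.mul_mem m _ (S.trans_mem h' hx) _ (S.trans_mem h' hy)

/-- The products `S.trans h x * S.trans h y` stay in the subspaces `E m`, where the next connecting
map is controlled, so that the multiplicative defects add up along the sequence. -/
lemma norm_trans_mul_sub_le {n m : ℕ} (h : n ≤ m) {x y : C n} (hx : x ∈ S.E n) (hy : y ∈ S.E n)
    (hxy : x * y ∈ S.E n) : ‖S.trans h (x * y) - S.trans h x * S.trans h y‖ ≤
      10 * (S.τ n - S.τ m) * ‖x‖ * ‖y‖ := by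
  induction m, h using Nat.le_induction with
  | base => simp [trans_self]
  | succ m h ih =>
    rw [S.trans_succ h, S.trans_succ h, S.trans_succ h]
    set a := S.trans h x with ha
    set b := S.trans h y with hb
    set c := S.trans h (x * y) with hc
    have haE : a ∈ S.E m := S.trans_mem h hx
    have hbE : b ∈ S.E m := S.trans_mem h hy
    have hab : a * b ∈ S.E m := by
      rcases h.eq_or_lt with rfl | h'
      · rw [ha, hb, trans_self]
        exact hxy
      · exact S.trans_mul_trans_mem h' hx hy
    have hcE : c ∈ S.E m := S.trans_mem h hxy
    have hτ := S.τ_pos m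
    have hτn := S.τ_le n
    have hτm := S.τ_le m
    have hna : ‖a‖ ≤ 26 / 25 * ‖x‖ := (S.norm_trans_le' h hx).trans (by gcongr; linarith)
    have hnb : ‖b‖ ≤ 26 / 25 * ‖y‖ := (S.norm_trans_le' h hy).trans (by gcongr; linarith)
    have h1 : S.Φ m c - S.Φ m a * S.Φ m b =
        S.Φ m (c - a * b) + (S.Φ m (a * b) - S.Φ m a * S.Φ m b) := by
      rw [map_sub]; abel
    rw [h1]
    calc ‖S.Φ m (c - a * b) + (S.Φ m (a * b) - S.Φ m a * S.Φ m b)‖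
        ≤ (1 + S.τ m) * ‖c - a * b‖ + S.τ m * ‖a‖ * ‖b‖ :=
          (norm_add_le _ _).trans (add_le_add (S.norm_le m _ (sub_mem hcE hab))
            (S.mul_le m a haE b hbE hab))
      _ ≤ (1 + S.τ m) * (10 * (S.τ n - S.τ m) * ‖x‖ * ‖y‖) +
          S.τ m * (26 / 25 * ‖x‖) * (26 / 25 * ‖y‖) := by gcongr
      _ = ((1 + S.τ m) * (10 * (S.τ n - S.τ m)) + S.τ m * (26 / 25) ^ 2) * (‖x‖ * ‖y‖) := by ring
      _ ≤ (10 * (S.τ n - S.τ (m + 1))) * (‖x‖ * ‖y‖) := by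
          gcongr
          nlinarith [S.τ_le_of_le h, S.τ_succ_le m, S.τ_pos n]
      _ = _ := by ring

lemma matNorm_map_trans_le {n m : ℕ} (h : n ≤ m) {N : ℕ} {x : Matrix (Fin N) (Fin N) (C n)}
    (hx : ∀ r s, x r s ∈ S.E n) :
    matNorm (x.map (S.trans h)) ≤ (1 + 4 * (S.τ n - S.τ m)) * matNorm x := by
  induction m, h using Nat.le_induction with
  | base => simp [trans_self]
  | succ m h ih =>
    have h1 : x.map (S.trans (Nat.le_succ_of_le h)) = (x.map (S.trans h)).map (S.Φ m) := by
      ext r s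
      exact S.trans_succ h _
    have := S.τ_pos m
    have := matNorm_nonneg x
    rw [h1]
    calc matNorm ((x.map (S.trans h)).map (S.Φ m)) ≤ (1 + S.τ m) * matNorm (x.map (S.trans h)) :=
          S.matNorm_map_le m N _ fun r s => S.trans_mem h (hx r s)
      _ ≤ (1 + S.τ m) * ((1 + 4 * (S.τ n - S.τ m)) * matNorm x) := by gcongr
      _ = ((1 + 4 * (S.τ n - S.τ m)) * (1 + S.τ m)) * matNorm x := by ring
      _ ≤ _ := by gcongr; exact S.telescope h

lemma le_matNorm_map_trans {n m : ℕ} (h : n ≤ m) {N : ℕ} {x : Matrix (Fin N) (Fin N) (C n)}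
    (hx : ∀ r s, x r s ∈ S.E n) :
    matNorm x ≤ (1 + 4 * (S.τ n - S.τ m)) * matNorm (x.map (S.trans h)) := by
  induction m, h using Nat.le_induction with
  | base => simp [trans_self]
  | succ m h ih =>
    have h1 : x.map (S.trans (Nat.le_succ_of_le h)) = (x.map (S.trans h)).map (S.Φ m) := by
      ext r s
      exact S.trans_succ h _
    have := S.τ_le_of_le h
    have := matNorm_nonneg ((x.map (S.trans h)).map (S.Φ m))
    rw [h1]
    calc matNorm x ≤ (1 + 4 * (S.τ n - S.τ m)) * matNorm (x.map (S.trans h)) := ih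
      _ ≤ (1 + 4 * (S.τ n - S.τ m)) * ((1 + S.τ m) * matNorm ((x.map (S.trans h)).map (S.Φ m))) := by
          refine mul_le_mul_of_nonneg_left ?_ (by linarith)
          exact S.le_matNorm_map m N _ fun r s => S.trans_mem h (hx r s)
      _ = ((1 + 4 * (S.τ n - S.τ m)) * (1 + S.τ m)) * matNorm ((x.map (S.trans h)).map (S.Φ m)) := by
          ring
      _ ≤ _ := by gcongr; exact S.telescope h

/-- The bounded sequence `(0, …, 0, x, Φ x, Φ (Φ x), …)` that starts with `x ∈ E n` in position
`n`. -/
def seq (n : ℕ) : S.E n →ₗ[ℂ] lp C ∞ where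
  toFun x := ⟨fun m => if h : n ≤ m then S.trans h x else 0, memℓp_infty ⟨(1 + 4 * S.τ n) * ‖x‖, by
    have := S.τ_pos n
    rintro _ ⟨m, rfl⟩
    dsimp only
    split_ifs with h
    · exact S.norm_trans_le' h x.2
    · rw [norm_zero]
      positivity⟩⟩
  map_add' x y := by
    ext m
    change (if h : n ≤ m then S.trans h ((x + y : S.E n) : C n) else 0) =
      (if h : n ≤ m then S.trans h (x : C n) else 0) + if h : n ≤ m then S.trans h (y : C n) else 0
    split_ifs <;> simp
  map_smul' c x := by
    ext m
    change (if h : n ≤ m then S.trans h ((c • x : S.E n) : C n) else 0) =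
      c • if h : n ≤ m then S.trans h (x : C n) else 0
    split_ifs <;> simp

lemma seq_apply {n m : ℕ} (h : n ≤ m) (x : S.E n) : S.seq n x m = S.trans h x := dif_pos h

/-- The embedding of `E n` into the corona algebra. -/
def toCorona (n : ℕ) : S.E n →ₗ[ℂ] Corona C := Corona.mk ∘ₗ S.seq n

lemma toCorona_Φ (n : ℕ) (x : S.E n) :
    S.toCorona (n + 1) ⟨S.Φ n x, S.map_mem n x x.2⟩ = S.toCorona n x := by
  refine Corona.mk_eq_mk.2 (mem_cZero.2 (tendsto_const_nhds.congr' ?_))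
  filter_upwards [eventually_ge_atTop (n + 1)] with m hm
  change 0 = ‖S.seq (n + 1) ⟨S.Φ n x, S.map_mem n x x.2⟩ m - S.seq n x m‖
  rw [S.seq_apply hm, S.seq_apply ((Nat.le_succ n).trans hm), S.trans_Φ hm, sub_self, norm_zero]

lemma toCorona_trans {n m : ℕ} (h : n ≤ m) (x : S.E n) :
    S.toCorona m ⟨S.trans h x, S.trans_mem h x.2⟩ = S.toCorona n x := by
  induction m, h using Nat.le_induction with
  | base => congr 1; ext1; simp [trans_self]
  | succ m h ih =>
    rw [← ih, ← S.toCorona_Φ m]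
    congr 1
    ext1
    exact S.trans_succ h _

lemma norm_toCorona_le (n : ℕ) (x : S.E n) : ‖S.toCorona n x‖ ≤ (1 + 4 * S.τ n) * ‖x‖ := by
  have := S.τ_pos n
  refine Corona.norm_mk_le_of_eventually (by positivity) ?_
  filter_upwards [eventually_ge_atTop n] with m hm
  rw [S.seq_apply hm]
  exact S.norm_trans_le' hm x.2

lemma norm_toCorona_mul_sub_le (n : ℕ) (x y : S.E n) (hxy : (x * y : C n) ∈ S.E n) :
    ‖S.toCorona n ⟨x * y, hxy⟩ - S.toCorona n x * S.toCorona n y‖ ≤ 10 * S.τ n * ‖x‖ * ‖y‖ := by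
  have := S.τ_pos n
  change ‖Corona.mk (S.seq n ⟨x * y, hxy⟩) - Corona.mk (S.seq n x) * Corona.mk (S.seq n y)‖ ≤ _
  rw [← Corona.mk_mul, ← map_sub]
  refine Corona.norm_mk_le_of_eventually (by positivity) ?_
  filter_upwards [eventually_ge_atTop n] with m hm
  change ‖S.seq n ⟨x * y, hxy⟩ m - S.seq n x m * S.seq n y m‖ ≤ _
  rw [S.seq_apply hm, S.seq_apply hm, S.seq_apply hm]
  refine (S.norm_trans_mul_sub_le hm x.2 y.2 hxy).trans ?_
  change _ ≤ 10 * S.τ n * ‖(x : C n)‖ * ‖(y : C n)‖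
  gcongr
  linarith [S.τ_pos m]

lemma toCorona_star (n : ℕ) (x : S.E n) (hx : star (x : C n) ∈ S.E n) :
    S.toCorona n ⟨star x, hx⟩ = star (S.toCorona n x) := by
  change Corona.mk _ = star (Corona.mk _)
  rw [← Corona.mk_star]
  congr 1
  ext m
  change dite _ _ _ = star (dite _ _ _)
  split_ifs with h
  · exact S.trans_star h x.2
  · exact (star_zero _).symm

lemma matNorm_map_toCorona_le (n : ℕ) {N : ℕ} (x : Matrix (Fin N) (Fin N) (S.E n)) :
    matNorm (x.map (S.toCorona n)) ≤ (1 + 4 * S.τ n) * matNorm (x.map fun e => (e : C n)) := by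
  have := S.τ_pos n
  have := matNorm_nonneg (x.map fun e => (e : C n))
  refine matNorm_map_mk_le (X := x.map (S.seq n)) (by positivity) ?_
  filter_upwards [eventually_ge_atTop n] with m hm
  have h : (x.map (S.seq n)).map (fun z => z m) = (x.map fun e => (e : C n)).map (S.trans hm) := by
    ext r s
    exact S.seq_apply hm _
  rw [h]
  refine (S.matNorm_map_trans_le hm (x := x.map fun e => (e : C n)) fun r s => (x r s).2).trans ?_
  gcongr
  linarith [S.τ_pos m]

lemma le_matNorm_map_toCorona (n : ℕ) {N : ℕ} (x : Matrix (Fin N) (Fin N) (S.E n)) :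
    matNorm (x.map fun e => (e : C n)) ≤ (1 + 4 * S.τ n) * matNorm (x.map (S.toCorona n)) := by
  have := S.τ_pos n
  rw [← div_le_iff₀' (by positivity)]
  refine le_matNorm_map_mk (X := x.map (S.seq n)) ?_
  filter_upwards [eventually_ge_atTop n] with m hm
  have h : (x.map (S.seq n)).map (fun z => z m) = (x.map fun e => (e : C n)).map (S.trans hm) := by
    ext r s
    exact S.seq_apply hm _
  rw [h, div_le_iff₀' (by positivity)]
  refine (S.le_matNorm_map_trans hm (x := x.map fun e => (e : C n)) fun r s => (x r s).2).trans ?_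
  have := matNorm_nonneg ((x.map fun e => (e : C n)).map (S.trans hm))
  gcongr
  linarith [S.τ_pos m]

lemma toCorona_injective (n : ℕ) : Function.Injective (S.toCorona n) := by
  refine (injective_iff_map_eq_zero _).2 fun x hx => ?_
  let X : Matrix (Fin 1) (Fin 1) (S.E n) := Matrix.of fun _ _ => x
  have h := S.le_matNorm_map_toCorona n X
  have h0 : X.map (S.toCorona n) = 0 := by
    ext r s
    exact hx
  rw [h0, matNorm_zero, mul_zero] at h
  have h1 : ‖(x : C n)‖ ≤ 0 := (norm_entry_le_matNorm (X.map fun e => (e : C n)) 0 0).trans h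
  exact Subtype.ext (norm_le_zero_iff.1 h1)

/-- The image of `E n` in the corona algebra. -/
def Y (n : ℕ) : Submodule ℂ (Corona C) := LinearMap.range (S.toCorona n)

lemma toCorona_mem (n : ℕ) (x : S.E n) : S.toCorona n x ∈ S.Y n := ⟨x, rfl⟩

lemma Y_mono : Monotone S.Y := by
  refine monotone_nat_of_le_succ fun n => ?_
  rintro _ ⟨x, rfl⟩
  exact ⟨⟨S.Φ n x, S.map_mem n x x.2⟩, S.toCorona_Φ n x⟩

lemma isFDSA_Y (n : ℕ) : IsFDSA (S.Y n) where
  finiteDimensional := by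
    have := (S.isFDSA n).finiteDimensional
    exact inferInstanceAs (FiniteDimensional ℂ (LinearMap.range (S.toCorona n)))
  star_mem := by
    rintro _ ⟨x, rfl⟩
    exact ⟨⟨star x, (S.isFDSA n).star_mem x x.2⟩, S.toCorona_star n x _⟩

lemma coe_iSup_Y : ((⨆ n, S.Y n : Submodule ℂ (Corona C)) : Set (Corona C)) = ⋃ n, (S.Y n : Set _) :=
  Submodule.coe_iSup_of_chain ⟨S.Y, S.Y_mono⟩

/-- The product of `x` and `y` in the corona algebra is the limit of the images of the products
`S.trans h x * S.trans h y` taken in `C m`, as `m → ∞`. -/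
lemma mul_mem_closure {a b : Corona C} (ha : a ∈ ⋃ n, (S.Y n : Set (Corona C)))
    (hb : b ∈ ⋃ n, (S.Y n : Set (Corona C))) : a * b ∈ closure (⋃ n, (S.Y n : Set (Corona C))) := by
  obtain ⟨n₁, ha⟩ := Set.mem_iUnion.1 ha
  obtain ⟨n₂, hb⟩ := Set.mem_iUnion.1 hb
  obtain ⟨x, hx⟩ := S.Y_mono (le_max_left n₁ n₂) ha
  obtain ⟨y, hy⟩ := S.Y_mono (le_max_right n₁ n₂) hb
  rw [← hx, ← hy]
  generalize max n₁ n₂ = n at x y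
  let z : ℕ → Corona C := fun m => if h : n < m then
    S.toCorona m ⟨S.trans h.le x * S.trans h.le y, S.trans_mul_trans_mem h x.2 y.2⟩ else 0
  have hz : ∀ m, z m ∈ ⋃ n, (S.Y n : Set (Corona C)) := fun m => by
    refine Set.mem_iUnion.2 ⟨m, ?_⟩
    dsimp only [z]
    split_ifs
    · exact S.toCorona_mem m _
    · exact (S.Y m).zero_mem
  refine mem_closure_of_tendsto (f := z) (b := atTop) ?_ (Eventually.of_forall hz)
  refine tendsto_iff_norm_sub_tendsto_zero.2 ?_
  have hlim : Tendsto (fun m => 10 * S.τ m * ((1 + 4 * S.τ n) * ‖x‖) * ((1 + 4 * S.τ n) * ‖y‖))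
      atTop (𝓝 0) := by
    have := ((S.tendsto_τ.const_mul 10).mul_const ((1 + 4 * S.τ n) * ‖x‖)).mul_const
      ((1 + 4 * S.τ n) * ‖y‖)
    simpa using this
  refine squeeze_zero' (Eventually.of_forall fun m => norm_nonneg _) ?_ hlim
  filter_upwards [eventually_gt_atTop n] with m hm
  have hzm : z m = S.toCorona m ⟨_, S.trans_mul_trans_mem hm x.2 y.2⟩ := dif_pos hm
  rw [hzm, ← S.toCorona_trans hm.le x, ← S.toCorona_trans hm.le y]
  have := S.τ_pos m
  have := S.τ_pos n
  refine (S.norm_toCorona_mul_sub_le m ⟨_, S.trans_mem hm.le x.2⟩ ⟨_, S.trans_mem hm.le y.2⟩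
    (S.trans_mul_trans_mem hm x.2 y.2)).trans ?_
  gcongr
  · exact S.norm_trans_le' hm.le x.2
  · exact S.norm_trans_le' hm.le y.2

/-- The closed union of the spaces `Y n`, a C*-subalgebra of the corona algebra. -/
def limit : NonUnitalStarSubalgebra ℂ (Corona C) where
  carrier := closure (⋃ n, (S.Y n : Set (Corona C)))
  zero_mem' := subset_closure (Set.mem_iUnion.2 ⟨0, (S.Y 0).zero_mem⟩)
  add_mem' {a b} ha hb := by
    rw [← S.coe_iSup_Y] at ha hb ⊢
    exact (⨆ n, S.Y n).topologicalClosure.add_mem ha hb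
  smul_mem' c a ha := by
    rw [← S.coe_iSup_Y] at ha ⊢
    exact (⨆ n, S.Y n).topologicalClosure.smul_mem c ha
  mul_mem' {a b} ha hb := by
    have := map_mem_closure₂ (f := fun a b : Corona C => a * b) continuous_mul ha hb
      fun a ha b hb => S.mul_mem_closure ha hb
    rwa [closure_closure] at this
  star_mem' {a} ha := by
    refine map_mem_closure continuous_star ha fun b hb => ?_
    obtain ⟨n, hb⟩ := Set.mem_iUnion.1 hb
    exact Set.mem_iUnion.2 ⟨n, (S.isFDSA_Y n).star_mem b hb⟩

lemma isClosed_limit : IsClosed (S.limit : Set (Corona C)) := isClosed_closure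

lemma Y_subset_limit (n : ℕ) : (S.Y n : Set (Corona C)) ⊆ S.limit :=
  (Set.subset_iUnion (fun n => (S.Y n : Set (Corona C))) n).trans subset_closure

/-- The identification of `Y n` with `E n`. -/
def β (n : ℕ) : S.Y n ≃ₗ[ℂ] S.E n :=
  (LinearEquiv.ofInjective (S.toCorona n) (S.toCorona_injective n)).symm

lemma coe_β_symm (n : ℕ) (x : S.E n) : ((S.β n).symm x : Corona C) = S.toCorona n x := rfl

lemma toCorona_β (n : ℕ) (y : S.Y n) : S.toCorona n (S.β n y) = y := by
  rw [← coe_β_symm, LinearEquiv.symm_apply_apply]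

lemma cbNorm_β_symm_le (n : ℕ) :
    cbNorm (S.β n).symm.toLinearMap ≤ ENNReal.ofReal (1 + 4 * S.τ n) :=
  cbNorm_le_ofReal _ (by linarith [S.τ_pos n]) fun _ x => S.matNorm_map_toCorona_le n x

lemma cbNorm_β_le (n : ℕ) : cbNorm (S.β n).toLinearMap ≤ ENNReal.ofReal (1 + 4 * S.τ n) := by
  refine cbNorm_le_ofReal _ (by linarith [S.τ_pos n]) fun N x => ?_
  refine (S.le_matNorm_map_toCorona n (x.map (S.β n))).trans (le_of_eq ?_)
  congr 2
  ext r s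
  exact S.toCorona_β n _

lemma isEpsMorphism_β_symm (n : ℕ) :
    IsEpsMorphism (10 * S.τ n) (S.E n) ((S.Y n).subtype ∘ₗ (S.β n).symm.toLinearMap) where
  norm_le x := by
    refine (S.norm_toCorona_le n x).trans ?_
    have := S.τ_pos n
    gcongr
    norm_num
  mul_le := S.norm_toCorona_mul_sub_le n
  star_eq := S.toCorona_star n

/-- An almost multiplicative `ψ` into `C n` becomes an almost multiplicative map into `Y n` if
`E n` contains its values and their products. -/
lemma isEpsMorphism_toCorona_comp (n : ℕ) {D : Type*} [NonUnitalCStarAlgebra D]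
    {F : Submodule ℂ D} {ψ : F →ₗ[ℂ] S.E n} {η : ℝ} (hη : S.τ n ≤ η / 2) (hη1 : η ≤ 1 / 100)
    (hψ : IsEpsMorphism η F ((S.E n).subtype ∘ₗ ψ))
    (hmul : ∀ x y, (ψ x * ψ y : C n) ∈ S.E n) :
    IsEpsMorphism (10 * η) F (S.toCorona n ∘ₗ ψ) where
  norm_le x := by
    have hτ := S.τ_pos n
    calc ‖S.toCorona n (ψ x)‖ ≤ (1 + 4 * S.τ n) * ‖ψ x‖ := S.norm_toCorona_le n _
      _ ≤ (1 + 4 * S.τ n) * ((1 + η) * ‖x‖) := by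
          gcongr
          exact hψ.norm_le x
      _ = ((1 + 4 * S.τ n) * (1 + η)) * ‖x‖ := by ring
      _ ≤ _ := by
          gcongr
          nlinarith
  mul_le x y hxy := by
    have hτ := S.τ_pos n
    have h1 : S.toCorona n (ψ ⟨x * y, hxy⟩) - S.toCorona n (ψ x) * S.toCorona n (ψ y) =
        S.toCorona n (ψ ⟨x * y, hxy⟩ - ⟨_, hmul x y⟩) +
        (S.toCorona n ⟨_, hmul x y⟩ - S.toCorona n (ψ x) * S.toCorona n (ψ y)) := by
      rw [map_sub]; abel
    have hx : ‖ψ x‖ ≤ 101 / 100 * ‖x‖ := (hψ.norm_le x).trans (by gcongr; linarith)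
    have hy : ‖ψ y‖ ≤ 101 / 100 * ‖y‖ := (hψ.norm_le y).trans (by gcongr; linarith)
    have h2 : ‖ψ ⟨x * y, hxy⟩ - ⟨_, hmul x y⟩‖ ≤ η * ‖x‖ * ‖y‖ := hψ.mul_le x y hxy
    simp only [LinearMap.comp_apply]
    rw [h1]
    calc _ ≤ (1 + 4 * S.τ n) * ‖ψ ⟨x * y, hxy⟩ - ⟨_, hmul x y⟩‖ + 10 * S.τ n * ‖ψ x‖ * ‖ψ y‖ :=
          (norm_add_le _ _).trans (add_le_add (S.norm_toCorona_le n _)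
            (S.norm_toCorona_mul_sub_le n _ _ _))
      _ ≤ (1 + 4 * S.τ n) * (η * ‖x‖ * ‖y‖) +
          10 * S.τ n * (101 / 100 * ‖x‖) * (101 / 100 * ‖y‖) := by gcongr
      _ = ((1 + 4 * S.τ n) * η + 10 * S.τ n * (101 / 100) ^ 2) * (‖x‖ * ‖y‖) := by ring
      _ ≤ (10 * η) * (‖x‖ * ‖y‖) := by
          gcongr
          nlinarith
      _ = _ := by ring
  star_eq x hx := by
    have h : ψ ⟨star x, hx⟩ = ⟨star (ψ x : C n), (S.isFDSA n).star_mem _ (ψ x).2⟩ :=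
      Subtype.ext (hψ.star_eq x hx)
    simp only [LinearMap.comp_apply]
    rw [h]
    exact S.toCorona_star n _ _

end ApproxSystem

end Construction

/-! ### Existence of the approximate inductive system -/

/-- By recursion: `E (n + 1)` is chosen to contain `ψ n (F n)` and its products, and `τ n` to be small
compared to the tolerances at `E n`, which only depend on `E n`. The connecting map is
`ψ n ∘ i n`, where `ψ n` lifts `F n` through `q n`. -/
lemma exists_approxSystem {C B : ℕ → Type*}
    [∀ n, NonUnitalCStarAlgebra (C n)] [∀ n, NonUnitalCStarAlgebra (B n)]
    (i : ∀ n, C n →⋆ₙₐ[ℂ] B n) (hi : ∀ n, Isometry (i n))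
    (q : ∀ n, C (n + 1) →⋆ₙₐ[ℂ] B n) (hql : ∀ n, AlmostAllowsLiftings (q n))
    (calE : ∀ n, Submodule ℂ (C n) → Submodule ℂ (B n))
    (hcalE : ∀ n E, IsFDSA E → IsFDSA (calE n E))
    (ε : ∀ n, Submodule ℂ (C n) → ℝ) (hε : ∀ n E, IsFDSA E → 0 < ε n E)
    (E₀ : ∀ n, Submodule ℂ (C n)) (hE₀ : ∀ n, IsFDSA (E₀ n))
    (δ : ℕ → ℝ) (hδ : ∀ n, 0 < δ n) (hLLP : ∀ n, HasLLP (C n)) :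
    ∃ (S : ApproxSystem C) (F : ∀ n, Submodule ℂ (B n)) (ψ : ∀ n, B n →ₗ[ℂ] C (n + 1)),
      (∀ n, E₀ n ≤ S.E n) ∧ (∀ n, 10 * S.τ n ≤ δ n) ∧ (∀ n, 10 * S.τ n ≤ ε n (S.E n)) ∧
      (∀ n, IsFDSA (F n)) ∧ (∀ n, calE n (S.E n) ≤ F n) ∧ (∀ n, ∀ x ∈ S.E n, i n x ∈ F n) ∧
      (∀ n, IsEpsMorphism (S.τ n) (F n) (ψ n ∘ₗ (F n).subtype)) ∧
      (∀ n, ∀ x ∈ F n, ψ n x ∈ S.E (n + 1)) ∧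
      (∀ n, ∀ x ∈ F n, ∀ y ∈ F n, ψ n x * ψ n y ∈ S.E (n + 1)) ∧
      ∀ n x, S.Φ n x = ψ n (i n x) := by
  -- the admissible pairs `(E, τ)` at stage `n`
  let St : ℕ → Type _ := fun n => {p : Submodule ℂ (C n) × ℝ // IsFDSA p.1 ∧ E₀ n ≤ p.1 ∧
    0 < p.2 ∧ p.2 ≤ 1 / 100 ∧ 10 * p.2 ≤ δ n ∧ 10 * p.2 ≤ ε n p.1}
  have hSt : ∀ n (E : Submodule ℂ (C n)) (t : ℝ), IsFDSA E → E₀ n ≤ E → 0 < t →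
      ∃ s : St n, s.1.1 = E ∧ s.1.2 ≤ t := fun n E t hE hE0 ht => by
    have hδn := hδ n
    have hεn := hε n E hE
    refine ⟨⟨(E, min t (min (1 / 100) (min (δ n / 10) (ε n E / 10)))), hE, hE0, by positivity,
      (min_le_right _ _).trans (min_le_left _ _), ?_, ?_⟩, rfl, min_le_left _ _⟩
    · have : min t (min (1 / 100) (min (δ n / 10) (ε n E / 10))) ≤ δ n / 10 :=
        (min_le_right _ _).trans ((min_le_right _ _).trans (min_le_left _ _))
      dsimp only
      linarith
    · have : min t (min (1 / 100) (min (δ n / 10) (ε n E / 10))) ≤ ε n E / 10 :=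
        (min_le_right _ _).trans ((min_le_right _ _).trans (min_le_right _ _))
      dsimp only
      linarith
  obtain ⟨s₀, -, -⟩ := hSt 0 (E₀ 0) 1 (hE₀ 0) le_rfl one_pos
  obtain ⟨s, hs⟩ := exists_dependent_seq (S := St) s₀ (P := fun n s t =>
    t.1.2 ≤ s.1.2 / 2 ∧
    ∃ (F : Submodule ℂ (B n)) (ψ : B n →ₗ[ℂ] C (n + 1)), IsFDSA F ∧ calE n s.1.1 ≤ F ∧
      (∀ x ∈ s.1.1, i n x ∈ F) ∧ IsEpsMorphism s.1.2 F (ψ ∘ₗ F.subtype) ∧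
      (∀ (N : ℕ) (x : Matrix (Fin N) (Fin N) (C n)), (∀ r r', x r r' ∈ s.1.1) →
        matNorm (x.map fun a => ψ (i n a)) ≤ (1 + s.1.2) * matNorm x ∧
        matNorm x ≤ (1 + s.1.2) * matNorm (x.map fun a => ψ (i n a))) ∧
      (∀ x ∈ F, ψ x ∈ t.1.1) ∧ ∀ x ∈ F, ∀ y ∈ F, ψ x * ψ y ∈ t.1.1) (by
    rintro n ⟨⟨E, τ⟩, hE, hE0, hτ, hτ1, -, -⟩
    dsimp only at hE hE0 hτ hτ1
    obtain ⟨F, ψ, hF, hGF, hiF, hψ, hcb⟩ := exists_lifting (hLLP n) (i n) (hi n) (q n) (hql n) hE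
      (hcalE n E hE) hτ (hτ1.trans (by norm_num))
    have hW : IsFDSA (F.map ψ) := hF.map ψ fun x hx => hψ.star_eq ⟨x, hx⟩ (hF.star_mem x hx)
    obtain ⟨t, htE, htτ⟩ := hSt (n + 1)
      (E₀ (n + 1) ⊔ (F.map ψ ⊔ Submodule.map₂ (LinearMap.mul ℂ (C (n + 1))) (F.map ψ) (F.map ψ)))
      (τ / 2) ((hE₀ _).sup (hW.sup hW.mul)) le_sup_left (half_pos hτ)
    refine ⟨t, htτ, F, ψ, hF, hGF, hiF, hψ, hcb, fun x hx => ?_, fun x hx y hy => ?_⟩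
    · rw [htE]
      exact Submodule.mem_sup_right (Submodule.mem_sup_left (Submodule.mem_map_of_mem hx))
    · rw [htE]
      exact Submodule.mem_sup_right (Submodule.mem_sup_right (Submodule.apply_mem_map₂ _
        (Submodule.mem_map_of_mem hx) (Submodule.mem_map_of_mem hy))))
  choose hτ F ψ hF hGF hiF hψ hcb hψF hψmul using hs
  have hnorm : ∀ n a, ‖i n a‖ = ‖a‖ := fun n => (hi n).norm_map_of_map_zero (map_zero (i n))
  let S : ApproxSystem C :=
    { E := fun n => (s n).1.1
      Φ := fun n => ψ n ∘ₗ (i n : C n →ₗ[ℂ] B n)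
      τ := fun n => (s n).1.2
      isFDSA := fun n => (s n).2.1
      τ_pos := fun n => (s n).2.2.2.1
      τ_le := fun n => (s n).2.2.2.2.1
      τ_succ_le := hτ
      map_mem := fun n x hx => hψF n _ (hiF n x hx)
      mul_mem := fun n x hx y hy => hψmul n _ (hiF n x hx) _ (hiF n y hy)
      norm_le := fun n x hx => by
        have h := (hψ n).norm_le ⟨i n x, hiF n x hx⟩
        rw [← hnorm n x]
        exact h
      mul_le := fun n x hx y hy hxy => by
        have h := (hψ n).mul_le ⟨i n x, hiF n x hx⟩ ⟨i n y, hiF n y hy⟩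
          (by rw [← map_mul]; exact hiF n _ hxy)
        rw [← hnorm n x, ← hnorm n y]
        refine le_trans (le_of_eq ?_) h
        change ‖ψ n (i n (x * y)) - _‖ = ‖ψ n (i n x * i n y) - _‖
        rw [map_mul]
        rfl
      map_star := fun n x hx => by
        have h := (hψ n).star_eq ⟨i n x, hiF n x hx⟩ ((hF n).star_mem _ (hiF n x hx))
        refine Eq.trans ?_ h
        change ψ n (i n (star x)) = ψ n (star (i n x))
        rw [map_star]
      matNorm_map_le := fun n N x hx => (hcb n N x hx).1
      le_matNorm_map := fun n N x hx => (hcb n N x hx).2 }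
  exact ⟨S, F, ψ, fun n => (s n).2.2.1, fun n => (s n).2.2.2.2.2.1, fun n => (s n).2.2.2.2.2.2,
    hF, hGF, hiF, hψ, hψF, hψmul, fun _ _ => rfl⟩

end WepLlp

end

open WepLlp Filter Topology in
theorem theorem9p2 {C B : ℕ → Type*}
    [∀ n, NonUnitalCStarAlgebra (C n)] [∀ n, NonUnitalCStarAlgebra (B n)]
    (i : ∀ n, C n →⋆ₙₐ[ℂ] B n) (hi : ∀ n, Isometry (i n))
    (q : ∀ n, C (n + 1) →⋆ₙₐ[ℂ] B n) (hq : ∀ n, Function.Surjective (q n))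
    (hql : ∀ n, AlmostAllowsLiftings (q n))
    (calE : ∀ n, Submodule ℂ (C n) → Submodule ℂ (B n))
    (hcalE : ∀ n E, IsFDSA E → IsFDSA (calE n E))
    (ε : ∀ n, Submodule ℂ (C n) → ℝ) (hε : ∀ n E, IsFDSA E → 0 < ε n E)
    (E₀ : ∀ n, Submodule ℂ (C n)) (hE₀ : ∀ n, IsFDSA (E₀ n))
    (δ : ℕ → ℝ) (hδ : ∀ n, 0 < δ n) (hδ0 : Tendsto δ atTop (𝓝 0))
    (hLLP : ∀ n, HasLLP (C n)) :
    ∃ (A : NonUnitalStarSubalgebra ℂ (Corona C)) (Y : ℕ → Submodule ℂ (Corona C))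
      (hY : ∀ n, Y n ≤ Y (n + 1)),
      IsClosed (A : Set (Corona C)) ∧
      (∀ n, IsFDSA (Y n)) ∧
      (∀ n, (Y n : Set (Corona C)) ⊆ A) ∧
      closure (⋃ n, (Y n : Set (Corona C))) = A ∧
      ∀ n, ∃ (E : Submodule ℂ (C n)) (F : Submodule ℂ (B n))
        (hEF : ∀ x ∈ E, (i n : C n →ₗ[ℂ] B n) x ∈ F)
        (β : Y n ≃ₗ[ℂ] E) (γ : F →ₗ[ℂ] Y (n + 1)),
        IsFDSA E ∧ IsFDSA F ∧ E₀ n ≤ E ∧ calE n E ≤ F ∧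
        γ ∘ₗ (i n : C n →ₗ[ℂ] B n).restrict hEF ∘ₗ β.toLinearMap = Submodule.inclusion (hY n) ∧
        max (cbNorm β.toLinearMap) (cbNorm β.symm.toLinearMap) ≤ ENNReal.ofReal (1 + δ n) ∧
        IsEpsMorphism (δ n) E ((Y n).subtype ∘ₗ β.symm.toLinearMap) ∧
        IsEpsMorphism (δ n) F ((Y (n + 1)).subtype ∘ₗ γ) ∧
        IsEpsMorphism (ε n E) F ((Y (n + 1)).subtype ∘ₗ γ) := by
  obtain ⟨S, F, ψ, hE₀S, hτδ, hτε, hF, hGF, hiF, hψ, hψF, hψmul, hΦ⟩ :=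
    exists_approxSystem i hi q hql calE hcalE ε hε E₀ hE₀ δ hδ hLLP
  refine ⟨S.limit, S.Y, fun n => S.Y_mono n.le_succ, S.isClosed_limit, S.isFDSA_Y,
    S.Y_subset_limit, rfl, fun n => ?_⟩
  let ψ' : F n →ₗ[ℂ] S.E (n + 1) := (ψ n).restrict (hψF n)
  have hγ : IsEpsMorphism (10 * S.τ n) (F n) (S.toCorona (n + 1) ∘ₗ ψ') :=
    S.isEpsMorphism_toCorona_comp (n + 1) (S.τ_succ_le n) (S.τ_le n) (hψ n)
      fun x y => hψmul n x x.2 y y.2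
  have h4 : ENNReal.ofReal (1 + 4 * S.τ n) ≤ ENNReal.ofReal (1 + δ n) :=
    ENNReal.ofReal_le_ofReal (by linarith [hτδ n, S.τ_pos n])
  refine ⟨S.E n, F n, hiF n, S.β n, (S.β (n + 1)).symm.toLinearMap ∘ₗ ψ', S.isFDSA n, hF n, hE₀S n,
    hGF n, ?_, max_le ((S.cbNorm_β_le n).trans h4) ((S.cbNorm_β_symm_le n).trans h4),
    (S.isEpsMorphism_β_symm n).mono (hτδ n), hγ.mono (hτδ n), hγ.mono (hτε n)⟩
  ext y
  change S.toCorona (n + 1) ⟨ψ n (i n (S.β n y)), _⟩ = (y : Corona C)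
  refine Eq.trans ?_ ((S.toCorona_Φ n (S.β n y)).trans (S.toCorona_β n y))
  congr 1
  exact Subtype.ext (hΦ n _).symm
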